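/- **Algorithm.** For a data set $D=(x_i,y_i)_{i\le n}\in(\mathbb R^p\times\mathbb R)^n$, a clipping threshold $\gamma>0$, a noise scale $\lambda>0$, a step size $\eta>0$ and a number of steps $T$, DP-GD started at $\theta_0=0$ is $$\theta_{t+1}=\theta_t-\frac{\eta}{n}\sum_{i=1}^n\mathrm{CLIP}_\gamma\bigl(-x_i(y_i-x_i^\top\theta_t)\bigr)+\eta z_t,\qquad 0\le t<T,$$ where $\mathrm{CLIP}_\gamma(v)=v\cdot\min\{1,\gamma/\|v\|\}$ and $z_0,\dots,z_{T-1}$ are independent with law $\mathcal N(0,\lambda^2 I_p)$. Its output is $(\theta_1,\dots,\theta_T)$. A mechanism $M$ is $\rho$-zCDP if $D_\alpha(M(D)\,\|\,M(D'))\le\rho\alpha$ for all $\alpha\in(1,\infty)$ and all data sets $D,D'$ that differ in at most one entry, where $D_\alpha(P\|Q)=\frac1{\alpha-1}\log\mathbf E_{Q}\bigl[(dP/dQ)^\alpha\bigr]$ is the Rényi divergence ($+\infty$ if $P\not\ll Q$). **Theorem.** There are absolute constants $C_0,b>0$ such that for all $\sigma_0>0$ and $m\in\mathbb N$ there are constants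 $a,C>0$ and exponents $k,l\in\mathbb N$, depending only on $\sigma_0$ and $m$, with the following property. Let $n\ge0$ and $p\ge 1$ be integers, $\theta^*\in\mathbb R^p$ with $\|\theta^*\|\le 1$, $\rho>0$, $\beta\in(0,1)$, and assume $$n\ge C_0\bigl(p+\log\tfrac1\beta\bigr).$$ (This forces $n\ge1$.) Put $L=1+\log(n/\beta)$, let $\sigma\ge\sigma_0/L^m$, and choose $$\gamma=a\,L^k\,\sigma\sqrt p,\qquad \eta=\tfrac14,\qquad T=\lceil b\,L\rceil,\qquad \lambda^2=\frac{2T\gamma^2}{\rho n^2}.$$ Then: 1. DP-GD with these parameters, started at $\theta_0=0$, is $\rho$-zCDP as a mechanism on data sets of size $n$. 2. If the data are drawn from the Gaussian generative model, i.e. $x_1,\dots,x_n$ are i.i.d. $\mathcal N(0,I_p)$ and $y_i=x_i^\top\theta^*+\xi_i$ with $\xi_1,\dots,\xi_n$ i.i.d. $\mathcal N(0,\sigma^2)$ independent of the $x_i$, then with probability at least $1-\beta$ over the data and the algorithm's noise (which is independent of the data) the final iterate satisfies $$\|\theta_T-\theta^*\|\le C\,L^l\left(\sqrt{\frac{\sigma^2p}{n}}+\frac{\sigma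 p}{\sqrt\rho\,n}\right).$$ -/

import Mathlib

open MeasureTheory ProbabilityTheory

noncomputable section

namespace DPGD

/-- The feature and parameter space `ℝ^p` with its Euclidean norm. -/
abbrev Vec (p : ℕ) : Type := EuclideanSpace ℝ (Fin p)

/-- A data set of `n` observations `(x_i, y_i)`, `x_i ∈ ℝ^p`, `y_i ∈ ℝ`. -/
abbrev Dataset (n p : ℕ) : Type := Fin n → Vec p × ℝ

/-- Norm clipping `CLIP_γ(v) = v · min {1, γ / ‖v‖}` (and `CLIP_γ(0) = 0`). -/
def clip {p : ℕ} (γ : ℝ) (v : Vec p) : Vec p := min 1 (γ / ‖v‖) • v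

/-- The average `(1/n) ∑ CLIP_γ(-x_i (y_i - ⟨x_i, θ⟩))` of the clipped per-example gradients. -/
def avgClippedGrad {n p : ℕ} (D : Dataset n p) (γ : ℝ) (θ : Vec p) : Vec p :=
  (n : ℝ)⁻¹ • ∑ i, clip γ (-(((D i).2 - inner ℝ (D i).1 θ) • (D i).1))

/-- The iterates `θ_0, …, θ_T` of gradient descent with clipping threshold `γ` and step size `η`,
started at `θ₀`, as a function of the data `D` and of the noise vectors: the step is
`θ_{t+1} = θ_t - η • g_t + η • z_t`. -/
def iterates {n p T : ℕ} (D : Dataset n p) (γ η : ℝ) (θ₀ : Vec p) (z : Fin T → Vec p) :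
    Fin (T + 1) → Vec p :=
  Fin.induction (motive := fun _ => Vec p) θ₀
    (fun t θ => θ - η • avgClippedGrad D γ θ + η • z t)

/-- The law `N(0, lam² I_p)`. -/
def sphericalGaussian (p : ℕ) (lam : ℝ) : Measure (Vec p) :=
  (stdGaussian (Vec p)).map (fun w => lam • w)

/-- The law of `T` independent noise vectors, each with law `N(0, lam² I_p)`. -/
def noiseLaw (p T : ℕ) (lam : ℝ) : Measure (Fin T → Vec p) :=
  Measure.pi (fun _ : Fin T => sphericalGaussian p lam)

/-- DP-GD as a randomized algorithm: the law of its output `(θ_1, …, θ_T)` on the data set `D`. -/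
def mechanism {n p : ℕ} (γ lam η : ℝ) (T : ℕ) (θ₀ : Vec p) (D : Dataset n p) :
    Measure (Fin T → Vec p) :=
  (noiseLaw p T lam).map (fun z t => iterates D γ η θ₀ z t.succ)

/-- The Gaussian generative setting: the law of `n` independent pairs `(x, y)` with
`x ∼ N(0, I_p)`, `y = ⟨x, θ⟩ + ξ`, and `ξ ∼ N(0, σ²)` independent of `x`. -/
def dataLaw (n p : ℕ) (θ : Vec p) (σ : ℝ) : Measure (Dataset n p) :=
  Measure.pi (fun _ : Fin n =>
    ((stdGaussian (Vec p)).prod (gaussianReal 0 (σ ^ 2).toNNReal)).map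
      (fun q : Vec p × ℝ => (q.1, inner ℝ q.1 θ + q.2)))

/-- The Rényi divergence of order `α > 1`: `(α - 1)⁻¹ log E_{y ∼ ν} [(dμ/dν (y))^α]`,
which is `+∞` when `μ` is not absolutely continuous with respect to `ν`. -/
def renyiDiv {Y : Type*} [MeasurableSpace Y] (α : ℝ) (μ ν : Measure Y) : EReal :=
  open Classical in
  if μ ≪ ν then
    (((α - 1)⁻¹ : ℝ) : EReal) * ENNReal.log (∫⁻ y, (μ.rnDeriv ν y) ^ α ∂ν)
  else ⊤

/-- `ρ`-zero-concentrated differential privacy of a mechanism on data sets of `n` records, given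
by the law `M x` of its output on each data set `x`. -/
def IsZCDP {X Y : Type*} [MeasurableSpace Y] {n : ℕ} (ρ : ℝ) (M : (Fin n → X) → Measure Y) :
    Prop :=
  ∀ x x' : Fin n → X, (∃ i, ∀ j, j ≠ i → x j = x' j) →
    ∀ α : ℝ, 1 < α → renyiDiv α (M x) (M x') ≤ ((ρ * α : ℝ) : EReal)

end DPGD

end

/-! Privacy. Given the iterates up to time `t`, the next one is Gaussian. Changing one record moves
its mean, measured in units of the noise vector `z t`, by at most `2γ/n`, because only one clipped
summand changes. By Cameron–Martin the two trajectory laws have a density that is a product of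
Gaussian shift densities. Its `α`-th moment is bounded by peeling off the first step
(`lintegral_noisyPath`, `lintegral_pathDensity_rpow_le`), and the chosen `λ` turns this bound into
exactly `exp ((α - 1) ρ α)`.

Utility. Clipping a vector `r • x` truncates the scalar residual `r` at the level `γ/‖x‖`, so the
clipped gradient is that of a Huber loss. Hence the gradients at `θ` and `θ*` differ by a weighted
Gram matrix applied to `u = θ - θ*`, with weights in `[0, 1]` that equal `1` wherever both residuals
are below the truncation level (`avgClippedGrad_sub_eq`). If the Gram matrix is at most `4n`, a step
of size `1/4` never expands `‖u‖`, apart from the gradient at `θ*` and the added noise. If moreover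
`‖u‖` is small against `γ/B`, where `B` bounds the features, then `∑ |⟨x_i, u⟩| ≥ n‖u‖/8` leaves
enough curvature for a contraction by `1 - 1/1024` (`norm_step_sub_le`). Non-expansion keeps the
iterates within distance `2` of `θ*` unless the accumulated error already exceeds `1`, in which case
the crude bound suffices (`norm_iterates_last_sub_le`).

Probability. The two conditions on the Gram matrix hold uniformly in `u` by a net of `33 ^ p` points
and exponential moments, which is where `n ≥ C₀ (p + log (1/β))` enters. Feature norms, residuals,
`∑ ξ_i x_i` and the noise vectors are controlled coordinate by coordinate with Gaussian tails at
level `L`. The hypothesis `σ ≥ σ₀ / L ^ m` serves twice: it makes `γ` large against the initial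
distance, and it lets the leftover bias `exp (-L) ≤ 1/n` be absorbed into the statistical rate. -/

namespace DPGD

open scoped ENNReal

/-! ### Gaussian shifts and their exponential moments -/

/-- Fubini for products of functions of distinct coordinates. -/
theorem lintegral_pi_prod {ι : Type*} [Fintype ι] {α : ι → Type*} [∀ i, MeasurableSpace (α i)]
    (μ : ∀ i, Measure (α i)) [∀ i, IsProbabilityMeasure (μ i)] (f : ∀ i, α i → ℝ≥0∞)
    (hf : ∀ i, Measurable (f i)) :
    ∫⁻ x, ∏ i, f i (x i) ∂Measure.pi μ = ∏ i, ∫⁻ y, f i y ∂μ i := by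
  have h := lintegral_prod_eq_prod_lintegral_of_indepFun (μ := Measure.pi μ) Finset.univ
    (fun i x => f i (x i)) (iIndepFun_pi (fun i => (hf i).aemeasurable))
    (fun i => (hf i).comp (measurable_pi_apply i))
  rw [h]
  refine Finset.prod_congr rfl fun i _ => ?_
  exact (measurePreserving_eval μ i).lintegral_comp (hf i)

theorem gaussianReal_eq_withDensity (d : ℝ) :
    gaussianReal d 1 = (gaussianReal 0 1).withDensity
      (fun x => ENNReal.ofReal (Real.exp (x * d - d ^ 2 / 2))) := by
  rw [gaussianReal_of_var_ne_zero _ one_ne_zero, gaussianReal_of_var_ne_zero _ one_ne_zero,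
    ← withDensity_mul _ (by fun_prop) (by fun_prop)]
  congr 1
  ext x
  simp only [gaussianPDF, gaussianPDFReal, Pi.mul_apply]
  rw [← ENNReal.ofReal_mul (by positivity), mul_assoc (_⁻¹), ← Real.exp_add]
  congr 3
  simp only [NNReal.coe_one]
  ring

theorem pi_gaussianReal_eq_withDensity {p : ℕ} (d : Fin p → ℝ) :
    Measure.pi (fun j => gaussianReal (d j) 1) =
      (Measure.pi (fun _ : Fin p => gaussianReal 0 1)).withDensity
        (fun x => ∏ j, ENNReal.ofReal (Real.exp (x j * d j - d j ^ 2 / 2))) := by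
  refine (Measure.pi_eq (μ := fun j => gaussianReal (d j) 1) fun s hs => ?_)
  rw [withDensity_apply _ (MeasurableSet.univ_pi hs), ← lintegral_indicator (MeasurableSet.univ_pi hs)]
  have : ∀ x : Fin p → ℝ, (Set.univ.pi s).indicator
      (fun x => ∏ j, ENNReal.ofReal (Real.exp (x j * d j - d j ^ 2 / 2))) x =
      ∏ j, (s j).indicator (fun y => ENNReal.ofReal (Real.exp (y * d j - d j ^ 2 / 2))) (x j) := by
    intro x
    by_cases hx : x ∈ Set.univ.pi s
    · rw [Set.indicator_of_mem hx]
      refine Finset.prod_congr rfl fun j _ => ?_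
      rw [Set.indicator_of_mem (hx j (Set.mem_univ j))]
    · rw [Set.indicator_of_notMem hx]
      simp only [Set.mem_univ_pi, not_forall] at hx
      obtain ⟨j, hj⟩ := hx
      symm
      exact Finset.prod_eq_zero (Finset.mem_univ j) (Set.indicator_of_notMem hj _)
  simp_rw [this]
  rw [lintegral_pi_prod _ _ (fun j => (by fun_prop : Measurable _).indicator (hs j))]
  refine Finset.prod_congr rfl fun j _ => ?_
  rw [lintegral_indicator (hs j), gaussianReal_eq_withDensity (d j), withDensity_apply _ (hs j)]

/-- The Cameron–Martin formula for the standard Gaussian on `ℝ^p`. -/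
theorem lintegral_stdGaussian_add {p : ℕ} (d : Vec p) {h : Vec p → ℝ≥0∞} (hh : Measurable h) :
    ∫⁻ w, h (w + d) ∂stdGaussian (Vec p) =
      ∫⁻ w, h w * ENNReal.ofReal (Real.exp (inner ℝ w d - ‖d‖ ^ 2 / 2)) ∂stdGaussian (Vec p) := by
  have hmeas : Measurable (WithLp.toLp 2 : (Fin p → ℝ) → Vec p) := by fun_prop
  rw [← map_pi_eq_stdGaussian, lintegral_map (by fun_prop) hmeas,
    lintegral_map (by fun_prop) hmeas]
  have hshift : Measure.pi (fun j => gaussianReal (d j) 1) =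
      (Measure.pi (fun _ : Fin p => gaussianReal 0 1)).map (fun x j => x j + d j) := by
    have := Measure.pi_map_pi (μ := fun _ : Fin p => gaussianReal 0 1)
      (f := fun j (x : ℝ) => x + d j) (fun j => by fun_prop)
    rw [this]
    congr 1
    ext1 j
    rw [gaussianReal_map_add_const, zero_add]
  have h1 : ∫⁻ x, h (WithLp.toLp 2 x) ∂Measure.pi (fun j => gaussianReal (d j) 1) =
      ∫⁻ x, h (WithLp.toLp 2 x + d) ∂Measure.pi (fun _ : Fin p => gaussianReal 0 1) := by
    rw [hshift, lintegral_map (by fun_prop) (by fun_prop)]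
    rfl
  rw [← h1, pi_gaussianReal_eq_withDensity,
    lintegral_withDensity_eq_lintegral_mul _ (by fun_prop) (by fun_prop)]
  refine lintegral_congr fun x => ?_
  rw [Pi.mul_apply, mul_comm, ← ENNReal.ofReal_prod_of_nonneg (fun _ _ => by positivity),
    ← Real.exp_sum, Finset.sum_sub_distrib, EuclideanSpace.real_norm_sq_eq, Finset.sum_div]
  simp [PiLp.inner_apply, mul_comm]

/-- Cameron–Martin with the constant function `1`: the shift density has total mass one. -/
theorem lintegral_exp_inner_stdGaussian {p : ℕ} (d : Vec p) :
    ∫⁻ w, ENNReal.ofReal (Real.exp (inner ℝ w d)) ∂stdGaussian (Vec p) =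
      ENNReal.ofReal (Real.exp (‖d‖ ^ 2 / 2)) := by
  have h := lintegral_stdGaussian_add d (h := fun _ => 1) measurable_const
  simp only [lintegral_one, measure_univ, one_mul, Real.exp_sub] at h
  have h2 : ∀ w : Vec p, ENNReal.ofReal (Real.exp (inner ℝ w d)) =
      ENNReal.ofReal (Real.exp (inner ℝ w d) / Real.exp (‖d‖ ^ 2 / 2)) *
        ENNReal.ofReal (Real.exp (‖d‖ ^ 2 / 2)) := by
    intro w
    rw [← ENNReal.ofReal_mul (by positivity), div_mul_cancel₀ _ (Real.exp_ne_zero _)]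
  simp_rw [h2]
  rw [lintegral_mul_const _ (by fun_prop), ← h, one_mul]

/-- The density at `z` of the law `N(d, lam² I)` with respect to `N(0, lam² I)`. -/
noncomputable def gaussianShiftDensity {p : ℕ} (lam : ℝ) (d z : Vec p) : ℝ≥0∞ :=
  ENNReal.ofReal (Real.exp ((inner ℝ z d - ‖d‖ ^ 2 / 2) / lam ^ 2))

theorem measurable_gaussianShiftDensity {Ω : Type*} [MeasurableSpace Ω] {p : ℕ} (lam : ℝ)
    {f g : Ω → Vec p} (hf : Measurable f) (hg : Measurable g) :
    Measurable (fun q => gaussianShiftDensity lam (f q) (g q)) := by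
  unfold gaussianShiftDensity
  fun_prop

instance isProbabilityMeasure_sphericalGaussian (p : ℕ) (lam : ℝ) :
    IsProbabilityMeasure (sphericalGaussian p lam) :=
  Measure.isProbabilityMeasure_map (by fun_prop)

instance isProbabilityMeasure_noiseLaw (p T : ℕ) (lam : ℝ) :
    IsProbabilityMeasure (noiseLaw p T lam) := by
  unfold noiseLaw; infer_instance

theorem lintegral_sphericalGaussian_add {p : ℕ} {lam : ℝ} (hlam : lam ≠ 0) (d : Vec p)
    {h : Vec p → ℝ≥0∞} (hh : Measurable h) :
    ∫⁻ z, h (z + d) ∂sphericalGaussian p lam =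
      ∫⁻ z, h z * gaussianShiftDensity lam d z ∂sphericalGaussian p lam := by
  have hm : Measurable (gaussianShiftDensity lam d) :=
    measurable_gaussianShiftDensity lam measurable_const measurable_id
  unfold sphericalGaussian
  rw [lintegral_map (by fun_prop) (by fun_prop), lintegral_map (by fun_prop) (by fun_prop)]
  have h1 := lintegral_stdGaussian_add (lam⁻¹ • d) (h := fun w => h (lam • w)) (by fun_prop)
  simp only [smul_add, smul_smul, mul_inv_cancel₀ hlam, one_smul] at h1
  rw [h1]
  refine lintegral_congr fun w => ?_
  rw [gaussianShiftDensity, inner_smul_right, inner_smul_left, norm_smul, mul_pow, norm_inv,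
    Real.norm_eq_abs, inv_pow, sq_abs]
  congr 3
  simp only [conj_trivial]
  field_simp

/-- A power of the density is again the exponential of an affine function of the Gaussian vector:
the linear part contributes `α²`, the normalization `-α`. -/
theorem lintegral_gaussianShiftDensity_rpow {p : ℕ} {lam : ℝ} (hlam : lam ≠ 0) (d : Vec p)
    (α : ℝ) :
    ∫⁻ z, gaussianShiftDensity lam d z ^ α ∂sphericalGaussian p lam =
      ENNReal.ofReal (Real.exp ((α ^ 2 - α) * ‖d‖ ^ 2 / (2 * lam ^ 2))) := by
  have hm : Measurable (gaussianShiftDensity lam d) :=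
    measurable_gaussianShiftDensity lam measurable_const measurable_id
  unfold sphericalGaussian
  rw [lintegral_map (by fun_prop) (by fun_prop)]
  have h2 : ∀ w : Vec p, gaussianShiftDensity lam d (lam • w) ^ α =
      ENNReal.ofReal (Real.exp (inner ℝ w ((α / lam) • d))) *
        ENNReal.ofReal (Real.exp (-(α * ‖d‖ ^ 2 / (2 * lam ^ 2)))) := by
    intro w
    rw [gaussianShiftDensity, ENNReal.ofReal_rpow_of_pos (Real.exp_pos _), ← Real.exp_mul,
      ← ENNReal.ofReal_mul (by positivity), ← Real.exp_add, inner_smul_right, inner_smul_left]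
    congr 2
    simp only [conj_trivial]
    field_simp
    ring
  simp_rw [h2]
  rw [lintegral_mul_const _ (by fun_prop), lintegral_exp_inner_stdGaussian,
    ← ENNReal.ofReal_mul (by positivity), ← Real.exp_add, norm_smul, mul_pow, norm_div, div_pow,
    Real.norm_eq_abs, Real.norm_eq_abs, sq_abs, sq_abs]
  congr 2
  field_simp
  ring

theorem lintegral_noiseLaw_succ {p T : ℕ} {lam : ℝ} {f : (Fin (T + 1) → Vec p) → ℝ≥0∞}
    (hf : Measurable f) :
    ∫⁻ z, f z ∂noiseLaw p (T + 1) lam =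
      ∫⁻ z₀, ∫⁻ z, f (Fin.cons z₀ z) ∂noiseLaw p T lam ∂sphericalGaussian p lam := by
  have h := (measurePreserving_piFinSuccAbove
    (fun _ : Fin (T + 1) => sphericalGaussian p lam) 0).symm
  unfold noiseLaw
  rw [← h.lintegral_comp hf, lintegral_prod _ (by fun_prop)]
  simp [MeasurableEquiv.piFinSuccAbove, Fin.insertNthEquiv]

/-! ### Likelihood ratio of two noisy trajectories -/

/-- The trajectory `θ_1, …, θ_T` of the recursion `θ ↦ G θ + η • z_t` started at `θ`. -/
noncomputable def noisyPath {p : ℕ} (G : Vec p → Vec p) (η : ℝ) :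
    (T : ℕ) → Vec p → (Fin T → Vec p) → (Fin T → Vec p)
  | 0, _, z => z
  | T + 1, θ, z => Fin.cons (G θ + η • z 0) (noisyPath G η T (G θ + η • z 0) (Fin.tail z))

theorem measurable_finCons {p T : ℕ} :
    Measurable (fun q : Vec p × (Fin T → Vec p) => (Fin.cons q.1 q.2 : Fin (T + 1) → Vec p)) := by
  refine measurable_pi_lambda _ fun i => ?_
  refine Fin.cases ?_ (fun j => ?_) i
  · simpa using measurable_fst
  · simpa using (by fun_prop : Measurable fun q : Vec p × (Fin T → Vec p) => q.2 j)

theorem measurable_finTail {p T : ℕ} :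
    Measurable (fun z : Fin (T + 1) → Vec p => (Fin.tail z : Fin T → Vec p)) :=
  measurable_pi_lambda _ fun i => measurable_pi_apply i.succ

theorem measurable_noisyPath {p : ℕ} {G : Vec p → Vec p} (hG : Measurable G) (η : ℝ) (T : ℕ) :
    Measurable (fun q : Vec p × (Fin T → Vec p) => noisyPath G η T q.1 q.2) := by
  induction T with
  | zero => exact measurable_snd
  | succ T ih =>
    have h1 : Measurable (fun q : Vec p × (Fin (T + 1) → Vec p) => G q.1 + η • q.2 0) := by
      fun_prop
    exact measurable_finCons.comp (h1.prodMk (ih.comp (h1.prodMk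
      (measurable_finTail.comp measurable_snd))))

theorem measurable_noisyPath_right {p : ℕ} {G : Vec p → Vec p} (hG : Measurable G) (η : ℝ)
    (T : ℕ) (θ : Vec p) : Measurable (noisyPath G η T θ) :=
  (measurable_noisyPath hG η T).comp measurable_prodMk_left

theorem noisyPath_cons {p : ℕ} (G : Vec p → Vec p) (η : ℝ) (T : ℕ) (θ z₀ : Vec p)
    (z : Fin T → Vec p) : noisyPath G η (T + 1) θ (Fin.cons z₀ z) =
      Fin.cons (G θ + η • z₀) (noisyPath G η T (G θ + η • z₀) z) := by
  simp [noisyPath]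

/-- The density of the trajectory of `G` with respect to the trajectory of `G'`. -/
noncomputable def pathDensity {p : ℕ} (G G' : Vec p → Vec p) (η lam : ℝ) :
    (T : ℕ) → Vec p → (Fin T → Vec p) → ℝ≥0∞
  | 0, _, _ => 1
  | T + 1, θ, y => gaussianShiftDensity lam (η⁻¹ • (G θ - G' θ)) (η⁻¹ • (y 0 - G' θ)) *
      pathDensity G G' η lam T (y 0) (Fin.tail y)

theorem measurable_pathDensity {p : ℕ} {G G' : Vec p → Vec p} (hG : Measurable G)
    (hG' : Measurable G') (η lam : ℝ) (T : ℕ) :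
    Measurable (fun q : Vec p × (Fin T → Vec p) => pathDensity G G' η lam T q.1 q.2) := by
  induction T with
  | zero => exact measurable_const
  | succ T ih =>
    refine Measurable.mul ?_ ?_
    · exact measurable_gaussianShiftDensity lam (by fun_prop) (by fun_prop)
    · exact ih.comp (Measurable.prodMk (by fun_prop) (measurable_finTail.comp measurable_snd))

theorem measurable_pathDensity_right {p : ℕ} {G G' : Vec p → Vec p} (hG : Measurable G)
    (hG' : Measurable G') (η lam : ℝ) (T : ℕ) (θ : Vec p) :
    Measurable (pathDensity G G' η lam T θ) :=
  (measurable_pathDensity hG hG' η lam T).comp measurable_prodMk_left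

theorem pathDensity_cons {p : ℕ} (G G' : Vec p → Vec p) {η : ℝ} (hη : η ≠ 0) (lam : ℝ) (T : ℕ)
    (θ z₀ : Vec p) (y : Fin T → Vec p) :
    pathDensity G G' η lam (T + 1) θ (Fin.cons (G' θ + η • z₀) y) =
      gaussianShiftDensity lam (η⁻¹ • (G θ - G' θ)) z₀ *
        pathDensity G G' η lam T (G' θ + η • z₀) y := by
  simp [pathDensity, smul_smul, hη]

/-- Change of measure one step at a time. It identifies `pathDensity` as the density between the two
output laws; the start `θ` is general because the induction restarts at the first iterate. -/
theorem lintegral_noisyPath {p : ℕ} {G G' : Vec p → Vec p} (hG : Measurable G)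
    (hG' : Measurable G') {η lam : ℝ} (hη : η ≠ 0) (hlam : lam ≠ 0) (T : ℕ) (θ : Vec p)
    {h : (Fin T → Vec p) → ℝ≥0∞} (hh : Measurable h) :
    ∫⁻ z, h (noisyPath G η T θ z) ∂noiseLaw p T lam =
      ∫⁻ z, h (noisyPath G' η T θ z) * pathDensity G G' η lam T θ (noisyPath G' η T θ z)
        ∂noiseLaw p T lam := by
  induction T generalizing θ with
  | zero => simp [pathDensity, noisyPath]
  | succ T ih =>
    have mp' := measurable_noisyPath hG' η T
    have mf := measurable_pathDensity hG hG' η lam T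
    have mPθ' := measurable_noisyPath_right hG' η (T + 1) θ
    have mFθ := measurable_pathDensity_right hG hG' η lam (T + 1) θ
    have mPθ := measurable_noisyPath_right hG η (T + 1) θ
    rw [lintegral_noiseLaw_succ (f := fun z => h (noisyPath G η (T + 1) θ z)) (hh.comp mPθ),
      lintegral_noiseLaw_succ (f := fun z => h (noisyPath G' η (T + 1) θ z) *
        pathDensity G G' η lam (T + 1) θ (noisyPath G' η (T + 1) θ z))
        (Measurable.mul (hh.comp mPθ') (mFθ.comp mPθ'))]
    let K : Vec p → ℝ≥0∞ := fun θ₁ => ∫⁻ z, h (Fin.cons θ₁ (noisyPath G' η T θ₁ z)) *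
        pathDensity G G' η lam T θ₁ (noisyPath G' η T θ₁ z) ∂noiseLaw p T lam
    have mK : Measurable K := by
      refine Measurable.lintegral_prod_right' (f := fun q : Vec p × (Fin T → Vec p) =>
        h (Fin.cons q.1 (noisyPath G' η T q.1 q.2)) *
        pathDensity G G' η lam T q.1 (noisyPath G' η T q.1 q.2)) ?_
      exact (hh.comp (measurable_finCons.comp (measurable_fst.prodMk mp'))).mul
        (mf.comp (measurable_fst.prodMk mp'))
    -- A step of `G` with noise `z₀` is a step of `G'` with noise shifted by `η⁻¹ • (G θ - G' θ)`;
    -- Cameron–Martin then removes the shift.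
    have h1 : ∀ z₀ : Vec p, ∫⁻ z, h (noisyPath G η (T + 1) θ (Fin.cons z₀ z)) ∂noiseLaw p T lam =
        K (G' θ + η • (z₀ + η⁻¹ • (G θ - G' θ))) := by
      intro z₀
      have e : G' θ + η • (z₀ + η⁻¹ • (G θ - G' θ)) = G θ + η • z₀ := by
        rw [smul_add, smul_smul, mul_inv_cancel₀ hη, one_smul]; abel
      rw [e]
      simp_rw [noisyPath_cons]
      exact ih _ (hh.comp (measurable_finCons.comp measurable_prodMk_left))
    simp_rw [h1]
    rw [lintegral_sphericalGaussian_add hlam (η⁻¹ • (G θ - G' θ))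
      (h := fun z => K (G' θ + η • z)) (by fun_prop)]
    refine lintegral_congr fun z₀ => ?_
    simp_rw [noisyPath_cons, pathDensity_cons G G' hη]
    rw [mul_comm, ← lintegral_const_mul]
    · refine lintegral_congr fun z => ?_
      ring
    · have m2 : Measurable (noisyPath G' η T (G' θ + η • z₀)) := mp'.comp measurable_prodMk_left
      exact (hh.comp (measurable_finCons.comp (measurable_const.prodMk m2))).mul
        (mf.comp (measurable_const.prodMk m2))

/-- Adaptive composition: the bound `Δ` is uniform in the current point, so the moment of the
remaining path is bounded by a constant that comes out of the integral over the first noise vector.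
-/
theorem lintegral_pathDensity_rpow_le {p : ℕ} {G G' : Vec p → Vec p} (hG : Measurable G)
    (hG' : Measurable G') {η lam Δ α : ℝ} (hη : η ≠ 0) (hlam : lam ≠ 0) (hα : 1 < α)
    (hΔ : ∀ θ, ‖η⁻¹ • (G θ - G' θ)‖ ≤ Δ) (T : ℕ) (θ : Vec p) :
    ∫⁻ z, pathDensity G G' η lam T θ (noisyPath G' η T θ z) ^ α ∂noiseLaw p T lam ≤
      ENNReal.ofReal (Real.exp ((α ^ 2 - α) * Δ ^ 2 / (2 * lam ^ 2))) ^ T := by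
  induction T generalizing θ with
  | zero => simp [pathDensity]
  | succ T ih =>
    have mPθ' := measurable_noisyPath_right hG' η (T + 1) θ
    rw [lintegral_noiseLaw_succ
      (f := fun z => pathDensity G G' η lam (T + 1) θ (noisyPath G' η (T + 1) θ z) ^ α)
      (((measurable_pathDensity_right hG hG' η lam (T + 1) θ).comp mPθ').pow_const α), pow_succ']
    set E := ENNReal.ofReal (Real.exp ((α ^ 2 - α) * Δ ^ 2 / (2 * lam ^ 2)))
    have hα0 : 0 ≤ α := by linarith
    calc _ ≤ ∫⁻ z₀, gaussianShiftDensity lam (η⁻¹ • (G θ - G' θ)) z₀ ^ α * E ^ T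
            ∂sphericalGaussian p lam := by
          refine lintegral_mono fun z₀ => ?_
          simp_rw [noisyPath_cons, pathDensity_cons G G' hη, ENNReal.mul_rpow_of_nonneg _ _ hα0]
          rw [lintegral_const_mul]
          · gcongr
            exact ih _
          · exact ((measurable_pathDensity hG hG' η lam T).comp (measurable_const.prodMk
              ((measurable_noisyPath hG' η T).comp measurable_prodMk_left))).pow_const α
      _ ≤ E * E ^ T := by
          rw [lintegral_mul_const]
          · gcongr
            rw [lintegral_gaussianShiftDensity_rpow hlam]
            refine ENNReal.ofReal_le_ofReal (Real.exp_le_exp.2 ?_)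
            have : 0 ≤ α ^ 2 - α := by nlinarith
            have := hΔ θ
            gcongr
          · exact (measurable_gaussianShiftDensity lam measurable_const measurable_id).pow_const α

/-! ### Sensitivity of the clipped gradient and zCDP -/

theorem norm_clip_le {p : ℕ} {γ : ℝ} (hγ : 0 ≤ γ) (v : Vec p) : ‖clip γ v‖ ≤ γ := by
  rw [clip, norm_smul, Real.norm_eq_abs, abs_of_nonneg (le_min zero_le_one (by positivity))]
  rcases eq_or_ne v 0 with rfl | hv
  · simpa using hγ
  · calc _ ≤ γ / ‖v‖ * ‖v‖ := by gcongr; exact min_le_right _ _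
      _ = γ := div_mul_cancel₀ _ (norm_ne_zero_iff.2 hv)

theorem measurable_clip {p : ℕ} (γ : ℝ) : Measurable (clip γ : Vec p → Vec p) := by
  unfold clip
  fun_prop

theorem measurable_avgClippedGrad {n p : ℕ} (D : Dataset n p) (γ : ℝ) :
    Measurable (avgClippedGrad D γ) := by
  unfold avgClippedGrad
  refine Measurable.const_smul (Finset.measurable_sum _ fun i _ => ?_) (n : ℝ)⁻¹
  exact (measurable_clip γ).comp (by fun_prop :
    Measurable fun θ : Vec p => -(((D i).2 - inner ℝ (D i).1 θ) • (D i).1))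

theorem norm_avgClippedGrad_sub_le {n p : ℕ} {γ : ℝ} (hγ : 0 ≤ γ) {D D' : Dataset n p}
    {i : Fin n} (h : ∀ j, j ≠ i → D j = D' j) (θ : Vec p) :
    ‖avgClippedGrad D γ θ - avgClippedGrad D' γ θ‖ ≤ 2 * γ / n := by
  rw [avgClippedGrad, avgClippedGrad, ← smul_sub, ← Finset.sum_sub_distrib,
    Finset.sum_eq_single i, norm_smul, norm_inv, Real.norm_natCast, div_eq_inv_mul]
  · gcongr
    refine (norm_sub_le _ _).trans ?_
    linarith [norm_clip_le hγ (-(((D i).2 - inner ℝ (D i).1 θ) • (D i).1)),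
      norm_clip_le hγ (-(((D' i).2 - inner ℝ (D' i).1 θ) • (D' i).1))]
  · intro j _ hj
    rw [h j hj, sub_self]
  · simp

theorem iterates_zero {n p T : ℕ} (D : Dataset n p) (γ η : ℝ) (θ : Vec p) (z : Fin T → Vec p) :
    iterates D γ η θ z 0 = θ := rfl

theorem iterates_succ {n p T : ℕ} (D : Dataset n p) (γ η : ℝ) (θ : Vec p) (z : Fin T → Vec p)
    (t : Fin T) : iterates D γ η θ z t.succ = iterates D γ η θ z t.castSucc -
      η • avgClippedGrad D γ (iterates D γ η θ z t.castSucc) + η • z t := rfl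

theorem iterates_cons {n p T : ℕ} (D : Dataset n p) (γ η : ℝ) (θ : Vec p)
    (z : Fin (T + 1) → Vec p) (t : Fin (T + 1)) : iterates D γ η θ z t.succ =
      iterates D γ η (θ - η • avgClippedGrad D γ θ + η • z 0) (Fin.tail z) t := by
  induction t using Fin.induction with
  | zero => rfl
  | succ t ih =>
    rw [iterates_succ, ← Fin.succ_castSucc, ih, iterates_succ]
    rfl

/-- `iterates` appends steps at the end, while `noisyPath` peels them off at the start, which is the
form suited to the inductions over the noise law. -/
theorem noisyPath_eq_iterates {n p : ℕ} (D : Dataset n p) (γ η : ℝ) (T : ℕ) (θ : Vec p)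
    (z : Fin T → Vec p) :
    noisyPath (fun θ => θ - η • avgClippedGrad D γ θ) η T θ z =
      fun t : Fin T => iterates D γ η θ z t.succ := by
  induction T generalizing θ with
  | zero => exact Subsingleton.elim _ _
  | succ T ih =>
    ext1 t
    rw [noisyPath, ih, iterates_cons]
    refine Fin.cases ?_ (fun s => ?_) t
    · rw [Fin.cons_zero, iterates_zero]
    · rw [Fin.cons_succ]

/-- Any explicit density agrees almost everywhere with the Radon–Nikodym derivative, so a moment
bound for it bounds the divergence. -/
theorem renyiDiv_le_of_withDensity {Y : Type*} [MeasurableSpace Y] {α : ℝ} (hα : 1 < α)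
    {μ ν : Measure Y} [SigmaFinite ν] {F : Y → ℝ≥0∞} (hF : Measurable F)
    (h : μ = ν.withDensity F) {r : ℝ}
    (hr : ∫⁻ y, F y ^ α ∂ν ≤ ENNReal.ofReal (Real.exp ((α - 1) * r))) :
    renyiDiv α μ ν ≤ (r : EReal) := by
  subst h
  rw [renyiDiv, if_pos (withDensity_absolutelyContinuous _ _)]
  have h1 : ∫⁻ y, ((ν.withDensity F).rnDeriv ν y) ^ α ∂ν = ∫⁻ y, F y ^ α ∂ν := by
    refine lintegral_congr_ae ?_
    filter_upwards [Measure.rnDeriv_withDensity ν hF] with y hy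
    rw [hy]
  rw [h1]
  have h2 : ENNReal.log (∫⁻ y, F y ^ α ∂ν) ≤ (((α - 1) * r : ℝ) : EReal) := by
    refine (ENNReal.log_le_log hr).trans ?_
    rw [ENNReal.log_ofReal_of_pos (Real.exp_pos _), Real.log_exp]
  have hα' : (0 : ℝ) < α - 1 := by linarith
  calc _ ≤ (((α - 1)⁻¹ : ℝ) : EReal) * (((α - 1) * r : ℝ) : EReal) := by
        refine mul_le_mul_of_nonneg_left h2 ?_
        exact_mod_cast (inv_pos.2 hα').le
    _ = (r : EReal) := by
        rw [← EReal.coe_mul]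
        congr 1
        field_simp

theorem isZCDP_mechanism {n p T : ℕ} (hn : 0 < n) (hT : 0 < T) {γ lam η ρ : ℝ} (hγ : 0 < γ)
    (hη : η ≠ 0) (hρ : 0 < ρ)
    (hlam : lam = Real.sqrt (2 * (T : ℝ) * γ ^ 2 / (ρ * (n : ℝ) ^ 2))) (θ₀ : Vec p) :
    IsZCDP ρ (fun D : Dataset n p => mechanism γ lam η T θ₀ D) := by
  rintro D D' ⟨i, hi⟩ α hα
  have hn' : (0 : ℝ) < n := by exact_mod_cast hn
  have hT' : (0 : ℝ) < T := by exact_mod_cast hT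
  have hlam2 : lam ^ 2 = 2 * (T : ℝ) * γ ^ 2 / (ρ * (n : ℝ) ^ 2) := by
    rw [hlam, Real.sq_sqrt (by positivity)]
  have hlam0 : lam ≠ 0 := by
    have : 0 < lam ^ 2 := by rw [hlam2]; positivity
    exact fun h => by simp [h] at this
  set G : Vec p → Vec p := fun θ => θ - η • avgClippedGrad D γ θ with hGdef
  set G' : Vec p → Vec p := fun θ => θ - η • avgClippedGrad D' γ θ with hGdef'
  have mG : Measurable G := measurable_id.sub ((measurable_avgClippedGrad D γ).const_smul η)
  have mG' : Measurable G' := measurable_id.sub ((measurable_avgClippedGrad D' γ).const_smul η)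
  have e : mechanism γ lam η T θ₀ D = (noiseLaw p T lam).map (noisyPath G η T θ₀) := by
    unfold mechanism
    congr 1
    ext1 z
    exact (noisyPath_eq_iterates D γ η T θ₀ z).symm
  have e' : mechanism γ lam η T θ₀ D' = (noiseLaw p T lam).map (noisyPath G' η T θ₀) := by
    unfold mechanism
    congr 1
    ext1 z
    exact (noisyPath_eq_iterates D' γ η T θ₀ z).symm
  have mP := measurable_noisyPath_right mG η T θ₀
  have mP' := measurable_noisyPath_right mG' η T θ₀
  have mF := measurable_pathDensity_right mG mG' η lam T θ₀
  have hΔ : ∀ θ, ‖η⁻¹ • (G θ - G' θ)‖ ≤ 2 * γ / n := by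
    intro θ
    have : η⁻¹ • (G θ - G' θ) = avgClippedGrad D' γ θ - avgClippedGrad D γ θ := by
      simp only [hGdef, hGdef', sub_sub_sub_cancel_left]
      rw [← smul_sub, smul_smul, inv_mul_cancel₀ hη, one_smul]
    rw [this, norm_sub_rev]
    exact norm_avgClippedGrad_sub_le hγ.le hi θ
  simp only [e, e']
  have : IsProbabilityMeasure ((noiseLaw p T lam).map (noisyPath G' η T θ₀)) :=
    Measure.isProbabilityMeasure_map mP'.aemeasurable
  refine renyiDiv_le_of_withDensity hα mF ?_ ?_
  · ext s hs
    have := lintegral_noisyPath mG mG' hη hlam0 T θ₀ (h := s.indicator 1)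
      (measurable_one.indicator hs)
    rw [withDensity_apply _ hs, ← lintegral_indicator hs, ← lintegral_indicator_one hs,
      lintegral_map (measurable_one.indicator hs) mP, this, lintegral_map (mF.indicator hs) mP']
    refine lintegral_congr fun z => ?_
    by_cases hz : noisyPath G' η T θ₀ z ∈ s <;> simp [hz]
  · rw [lintegral_map (mF.pow_const α) mP']
    refine (lintegral_pathDensity_rpow_le mG mG' hη hlam0 hα hΔ T θ₀).trans (le_of_eq ?_)
    -- The noise scale is calibrated for equality: `T (α² - α) (2γ/n)² / (2 λ²) = (α - 1) ρ α`.
    rw [← ENNReal.ofReal_pow (by positivity), ← Real.exp_nat_mul, hlam2]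
    congr 2
    field_simp

/-! ### Clipping as truncation of residuals -/

/-- A clipped per-example gradient is the gradient of a Huber loss: the residual is truncated at
a level `c`. -/
theorem exists_clip_eq_truncate {p : ℕ} {γ B : ℝ} (hγ : 0 < γ) (hB : 0 < B) {x : Vec p}
    (hx : ‖x‖ ≤ B) :
    ∃ c, γ / B ≤ c ∧ ∀ r : ℝ, clip γ (-(r • x)) = -(max (-c) (min c r) • x) := by
  rcases eq_or_ne x 0 with rfl | h0
  · exact ⟨γ / B, le_rfl, fun r => by simp [clip]⟩
  have hx0 : 0 < ‖x‖ := norm_pos_iff.2 h0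
  refine ⟨γ / ‖x‖, by gcongr, fun r => ?_⟩
  have hc : 0 < γ / ‖x‖ := by positivity
  rw [clip, smul_neg, smul_smul, norm_neg, norm_smul, Real.norm_eq_abs]
  congr 2
  rcases eq_or_ne r 0 with rfl | hr
  · simp [hc.le]
  have hr0 : 0 < |r| := abs_pos.2 hr
  have e : γ / (|r| * ‖x‖) = γ / ‖x‖ / |r| := by field_simp
  rw [e]
  generalize γ / ‖x‖ = c at *
  rcases le_total |r| c with h | h
  · rw [min_eq_left ((one_le_div hr0).2 h), min_eq_right (abs_le.1 h).2,
      max_eq_right (abs_le.1 h).1, one_mul]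
  · rw [min_eq_right ((div_le_one hr0).2 h)]
    rcases lt_or_gt_of_ne hr with h' | h'
    · rw [abs_of_neg h'] at *
      rw [min_eq_right (by linarith), max_eq_left (by linarith)]
      field_simp
    · rw [abs_of_pos h'] at *
      rw [min_eq_left h, max_eq_right (by linarith)]
      field_simp

/-- Truncation has slopes in `[0, 1]`, and slope `1` below the threshold. -/
theorem exists_truncate_sub_eq {c : ℝ} (hc : 0 ≤ c) (r s : ℝ) :
    ∃ w, 0 ≤ w ∧ w ≤ 1 ∧ max (-c) (min c r) - max (-c) (min c s) = w * (r - s) ∧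
      (|r| ≤ c → |s| ≤ c → w = 1) := by
  wlog h : s ≤ r generalizing r s
  · obtain ⟨w, h0, h1, h2, h3⟩ := this s r (le_of_not_ge h)
    exact ⟨w, h0, h1, by linarith, fun a b => h3 b a⟩
  rcases h.eq_or_lt with rfl | h
  · exact ⟨1, by norm_num, le_rfl, by simp, fun _ _ => rfl⟩
  have hd : 0 < r - s := by linarith
  refine ⟨(max (-c) (min c r) - max (-c) (min c s)) / (r - s), ?_, ?_, ?_, ?_⟩
  · refine div_nonneg (sub_nonneg.2 ?_) hd.le
    gcongr
  · rw [div_le_one hd]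
    rcases max_cases (-c) (min c r) with h1 | h1 <;> rcases max_cases (-c) (min c s) with h2 | h2 <;>
      rcases min_cases c r with h3 | h3 <;> rcases min_cases c s with h4 | h4 <;> linarith
  · field_simp
  · intro hr hs
    rw [min_eq_right (abs_le.1 hr).2, max_eq_right (abs_le.1 hr).1,
      min_eq_right (abs_le.1 hs).2, max_eq_right (abs_le.1 hs).1, div_self hd.ne']

/-- A mean value form of the Huber gradient: `w i` is the slope of the truncation between the two
residuals. The levels vary with the example but are all at least `γ / B`. -/
theorem avgClippedGrad_sub_eq {n p : ℕ} (D : Dataset n p) {γ B : ℝ} (hγ : 0 < γ) (hB : 0 < B)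
    (hD : ∀ i, ‖(D i).1‖ ≤ B) (θ θ' : Vec p) :
    ∃ w : Fin n → ℝ, (∀ i, 0 ≤ w i ∧ w i ≤ 1) ∧
      avgClippedGrad D γ θ - avgClippedGrad D γ θ' =
        (n : ℝ)⁻¹ • ∑ i, (w i * inner ℝ (D i).1 (θ - θ')) • (D i).1 ∧
      ∀ i, |(D i).2 - inner ℝ (D i).1 θ| ≤ γ / B → |(D i).2 - inner ℝ (D i).1 θ'| ≤ γ / B →
        w i = 1 := by
  choose c hcB hc using fun i => exists_clip_eq_truncate hγ hB (hD i)
  have hc0 : ∀ i, 0 ≤ c i := fun i => le_trans (by positivity) (hcB i)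
  choose w h0 h1 hw hw1 using fun i => exists_truncate_sub_eq (hc0 i)
    ((D i).2 - inner ℝ (D i).1 θ) ((D i).2 - inner ℝ (D i).1 θ')
  refine ⟨w, fun i => ⟨h0 i, h1 i⟩, ?_, fun i ha hb => hw1 i (ha.trans (hcB i)) (hb.trans (hcB i))⟩
  rw [avgClippedGrad, avgClippedGrad, ← smul_sub, ← Finset.sum_sub_distrib]
  congr 1
  refine Finset.sum_congr rfl fun i _ => ?_
  rw [hc, hc, ← neg_smul, ← neg_smul, ← sub_smul]
  congr 1
  have := hw i
  rw [inner_sub_right]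
  linarith

/-- The averaged clipped gradient at a parameter where no example is clipped. -/
theorem avgClippedGrad_eq_of_abs_le {n p : ℕ} (D : Dataset n p) {γ B : ℝ} (hγ : 0 < γ)
    (hB : 0 < B) (hD : ∀ i, ‖(D i).1‖ ≤ B) (θ : Vec p)
    (h : ∀ i, |(D i).2 - inner ℝ (D i).1 θ| ≤ γ / B) :
    avgClippedGrad D γ θ =
      (n : ℝ)⁻¹ • -∑ i, ((D i).2 - inner ℝ (D i).1 θ) • (D i).1 := by
  rw [avgClippedGrad, ← Finset.sum_neg_distrib]
  congr 1
  refine Finset.sum_congr rfl fun i _ => ?_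
  obtain ⟨c, hcB, hc⟩ := exists_clip_eq_truncate hγ hB (hD i)
  have := abs_le.1 ((h i).trans hcB)
  rw [hc, min_eq_right this.2, max_eq_right this.1]

/-! ### Contraction of a gradient step -/

section Weighted

variable {n p : ℕ} {x : Fin n → Vec p} {w : Fin n → ℝ}

/-- With `v` the weighted gradient and `q = ⟨u, v⟩`, the Gram bound gives `‖v‖² ≤ 4q`, hence `‖u -
v/4‖² ≤ ‖u‖² - q/2 + q/4`. -/
theorem norm_sub_weighted_sq_le (hn : 0 < n) (hw : ∀ i, 0 ≤ w i ∧ w i ≤ 1)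
    (hx : ∀ u : Vec p, ∑ i, inner ℝ (x i) u ^ 2 ≤ 4 * n * ‖u‖ ^ 2) (u : Vec p) :
    ‖u - (1 / 4 : ℝ) • (n : ℝ)⁻¹ • ∑ i, (w i * inner ℝ (x i) u) • x i‖ ^ 2 ≤
      ‖u‖ ^ 2 - (n : ℝ)⁻¹ * (∑ i, w i * inner ℝ (x i) u ^ 2) / 4 := by
  have hn' : (0 : ℝ) < n := by exact_mod_cast hn
  set v : Vec p := (n : ℝ)⁻¹ • ∑ i, (w i * inner ℝ (x i) u) • x i with hv
  have hinner : ∀ z : Vec p, inner ℝ z v =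
      (n : ℝ)⁻¹ * ∑ i, w i * inner ℝ (x i) u * inner ℝ (x i) z := by
    intro z
    rw [hv, inner_smul_right, inner_sum]
    congr 1
    refine Finset.sum_congr rfl fun i _ => ?_
    rw [inner_smul_right, real_inner_comm z]
  set q := (n : ℝ)⁻¹ * ∑ i, w i * inner ℝ (x i) u ^ 2 with hq
  have hu : inner ℝ u v = q := by
    rw [hinner, hq]
    congr 1
    exact Finset.sum_congr rfl fun i _ => by ring
  have hvv : ‖v‖ ^ 2 ≤ 4 * q := by
    have h1 : ‖v‖ ^ 2 ≤ 2 * q + (n : ℝ)⁻¹ * ((4 * n * ‖v‖ ^ 2) / 8) := by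
      have e1 := hinner v
      rw [real_inner_self_eq_norm_sq] at e1
      have e2 : 2 * q + (n : ℝ)⁻¹ * ((4 * n * ‖v‖ ^ 2) / 8) =
          (n : ℝ)⁻¹ * (2 * ∑ i, w i * inner ℝ (x i) u ^ 2 + (4 * n * ‖v‖ ^ 2) / 8) := by
        rw [hq]; ring
      rw [e2]
      nth_rewrite 1 [e1]
      refine mul_le_mul_of_nonneg_left ?_ (by positivity)
      refine le_trans ?_ (add_le_add_right (div_le_div_of_nonneg_right (hx v) (by norm_num)) _)
      rw [Finset.mul_sum, Finset.sum_div, ← Finset.sum_add_distrib]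
      refine Finset.sum_le_sum fun i _ => ?_
      have h0 := (hw i).1
      have h1 := (hw i).2
      -- With `a = ⟨x_i, u⟩` and `b = ⟨x_i, v⟩` this is `w a b ≤ 2 w a² + b²/8`, valid for `w ≤ 1`.
      nlinarith [mul_nonneg h0 (sq_nonneg (4 * inner ℝ (x i) u - inner ℝ (x i) v)),
        mul_nonneg (sub_nonneg.2 h1) (sq_nonneg (inner ℝ (x i) v))]
    have h2 : (n : ℝ)⁻¹ * ((4 * n * ‖v‖ ^ 2) / 8) = ‖v‖ ^ 2 / 2 := by field_simp; ring
    linarith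
  rw [norm_sub_sq_real, inner_smul_right, hu, norm_smul, mul_pow]
  norm_num
  linarith

/-- Strong convexity from the examples whose residual is below the threshold. -/
theorem weighted_sq_ge (hn : 0 < n) (hw : ∀ i, 0 ≤ w i)
    (hx : ∀ u : Vec p, ∑ i, inner ℝ (x i) u ^ 2 ≤ 4 * n * ‖u‖ ^ 2)
    (hx1 : ∀ u : Vec p, n * ‖u‖ / 8 ≤ ∑ i, |inner ℝ (x i) u|) (u : Vec p)
    (hw1 : ∀ i, |inner ℝ (x i) u| ≤ 128 * ‖u‖ → w i = 1) :
    ‖u‖ ^ 2 / 128 ≤ (n : ℝ)⁻¹ * ∑ i, w i * inner ℝ (x i) u ^ 2 := by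
  have hn' : (0 : ℝ) < n := by exact_mod_cast hn
  -- Examples with `|⟨x_i, u⟩| ≤ 128 ‖u‖` have weight `1` and are handled by AM–GM; for the others
  -- the last term suffices. After summation the first and third terms cost `n‖u‖²/32` each, out of
  -- the available `n‖u‖²/8`.
  have key : ∀ i, |inner ℝ (x i) u| * ‖u‖ ≤
      ‖u‖ ^ 2 / 32 + 8 * (w i * inner ℝ (x i) u ^ 2) + inner ℝ (x i) u ^ 2 / 128 := by
    intro i
    rw [← sq_abs (inner ℝ (x i) u)]
    have h0 := abs_nonneg (inner ℝ (x i) u)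
    have hu := norm_nonneg u
    rcases le_or_gt |inner ℝ (x i) u| (128 * ‖u‖) with h | h
    · rw [hw1 i h]
      nlinarith [sq_nonneg (16 * |inner ℝ (x i) u| - ‖u‖)]
    · nlinarith [mul_nonneg (hw i) (sq_nonneg |inner ℝ (x i) u|)]
  have h1 := Finset.sum_le_sum fun i (_ : i ∈ Finset.univ) => key i
  rw [← Finset.sum_mul, Finset.sum_add_distrib, Finset.sum_add_distrib, ← Finset.mul_sum,
    ← Finset.sum_div, ← Finset.sum_div] at h1
  simp only [Finset.sum_const, Finset.card_univ, Fintype.card_fin, nsmul_eq_mul] at h1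
  have h2 := mul_le_mul_of_nonneg_right (hx1 u) (norm_nonneg u)
  have h3 := hx u
  rw [inv_mul_eq_div, le_div_iff₀ hn']
  nlinarith

end Weighted

/-- The gradient at `θs` is unclipped and contributes `g / 4`. Far from `θs` clipping may destroy
curvature, so only non-expansion holds; nearby, the examples counted by `weighted_sq_ge` have both
residuals below `γ / B`. The rate comes from `1 - 1/512 ≤ (1 - 1/1024)²`. -/
theorem norm_step_sub_le {n p : ℕ} (hn : 0 < n) (D : Dataset n p) {γ B g : ℝ} (hγ : 0 < γ)
    (hB : 0 < B) (hD : ∀ i, ‖(D i).1‖ ≤ B)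
    (hx : ∀ u : Vec p, ∑ i, inner ℝ (D i).1 u ^ 2 ≤ 4 * n * ‖u‖ ^ 2)
    (hx1 : ∀ u : Vec p, n * ‖u‖ / 8 ≤ ∑ i, |inner ℝ (D i).1 u|) (θs : Vec p)
    (hξ : ∀ i, |(D i).2 - inner ℝ (D i).1 θs| ≤ γ / (2 * B))
    (hg : ‖∑ i, ((D i).2 - inner ℝ (D i).1 θs) • (D i).1‖ ≤ n * g) (θ : Vec p) :
    ‖θ - (1 / 4 : ℝ) • avgClippedGrad D γ θ - θs‖ ≤ ‖θ - θs‖ + g / 4 ∧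
    (128 * ‖θ - θs‖ ≤ γ / (2 * B) →
      ‖θ - (1 / 4 : ℝ) • avgClippedGrad D γ θ - θs‖ ≤ (1 - 1 / 1024) * ‖θ - θs‖ + g / 4) := by
  have hn' : (0 : ℝ) < n := by exact_mod_cast hn
  have hU : 0 < γ / (2 * B) := by positivity
  have hU2 : γ / B = 2 * (γ / (2 * B)) := by field_simp
  obtain ⟨w, hw, hsub, hw1⟩ := avgClippedGrad_sub_eq D hγ hB hD θ θs
  have hstar := avgClippedGrad_eq_of_abs_le D hγ hB hD θs
    (fun i => (hξ i).trans (by rw [hU2]; linarith))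
  set u := θ - θs with hu
  set A : Vec p := (1 / 4 : ℝ) • (n : ℝ)⁻¹ • ∑ i, (w i * inner ℝ (D i).1 u) • (D i).1 with hA
  have hsq := norm_sub_weighted_sq_le hn hw hx u
  have hq0 : 0 ≤ (n : ℝ)⁻¹ * ∑ i, w i * inner ℝ (D i).1 u ^ 2 :=
    mul_nonneg (by positivity) (Finset.sum_nonneg fun i _ => mul_nonneg (hw i).1 (sq_nonneg _))
  have hsplit : ‖θ - (1 / 4 : ℝ) • avgClippedGrad D γ θ - θs‖ ≤ ‖u - A‖ + g / 4 := by
    have e : θ - (1 / 4 : ℝ) • avgClippedGrad D γ θ - θs =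
        (u - A) - (1 / 4 : ℝ) • avgClippedGrad D γ θs := by
      rw [hA, ← hsub, smul_sub, hu]
      abel
    rw [e]
    refine (norm_sub_le _ _).trans ?_
    gcongr
    rw [hstar, norm_smul, norm_smul, norm_neg, norm_inv, Real.norm_natCast]
    have : (n : ℝ)⁻¹ * ‖∑ i, ((D i).2 - inner ℝ (D i).1 θs) • (D i).1‖ ≤ g := by
      rw [inv_mul_le_iff₀ hn']; exact hg
    norm_num
    linarith
  refine ⟨hsplit.trans ?_, fun hsmall => hsplit.trans ?_⟩
  · gcongr
    exact abs_le_of_sq_le_sq' (by linarith) (norm_nonneg u) |>.2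
  · gcongr
    refine abs_le_of_sq_le_sq' ?_ (mul_nonneg (by norm_num) (norm_nonneg u)) |>.2
    have := weighted_sq_ge hn (fun i => (hw i).1) hx hx1 u (fun i hi => by
      have h1 := hξ i
      refine hw1 i ?_ (by linarith)
      have e : (D i).2 - inner ℝ (D i).1 θ =
          ((D i).2 - inner ℝ (D i).1 θs) - inner ℝ (D i).1 u := by
        rw [hu, inner_sub_right]; ring
      rw [e]
      refine (abs_sub _ _).trans ?_
      linarith)
    rw [mul_pow]
    nlinarith [sq_nonneg ‖u‖]

/-- Deterministic convergence of clipped noisy gradient descent for well-conditioned data. -/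
theorem norm_iterates_last_sub_le {n p T : ℕ} (hn : 0 < n) (hT : 0 < T) (D : Dataset n p)
    {γ B g N : ℝ}
    (hγ : 0 < γ) (hB : 0 < B) (hg0 : 0 ≤ g) (hN0 : 0 ≤ N) (hD : ∀ i, ‖(D i).1‖ ≤ B)
    (hx : ∀ u : Vec p, ∑ i, inner ℝ (D i).1 u ^ 2 ≤ 4 * n * ‖u‖ ^ 2)
    (hx1 : ∀ u : Vec p, n * ‖u‖ / 8 ≤ ∑ i, |inner ℝ (D i).1 u|) {θs : Vec p} (hθs : ‖θs‖ ≤ 1)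
    (hξ : ∀ i, |(D i).2 - inner ℝ (D i).1 θs| ≤ γ / (2 * B)) (hU : 256 ≤ γ / (2 * B))
    (hg : ‖∑ i, ((D i).2 - inner ℝ (D i).1 θs) • (D i).1‖ ≤ n * g)
    {z : Fin T → Vec p} (hz : ∀ t, ‖z t‖ ≤ N) :
    ‖iterates D γ (1 / 4) 0 z (Fin.last T) - θs‖ ≤ (1 - 1 / 1024) ^ T + 2 * (T * (g + N)) := by
  have hstep := norm_step_sub_le hn D hγ hB hD hx hx1 θs hξ hg
  set e : Fin (T + 1) → ℝ := fun t => ‖iterates D γ (1 / 4) 0 z t - θs‖ with he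
  have hsucc : ∀ t : Fin T, e t.succ ≤
      ‖iterates D γ (1 / 4) 0 z t.castSucc -
        (1 / 4 : ℝ) • avgClippedGrad D γ (iterates D γ (1 / 4) 0 z t.castSucc) - θs‖ + N / 4 := by
    intro t
    have e1 : iterates D γ (1 / 4) 0 z t.succ - θs = (iterates D γ (1 / 4) 0 z t.castSucc -
        (1 / 4 : ℝ) • avgClippedGrad D γ (iterates D γ (1 / 4) 0 z t.castSucc) - θs) +
        (1 / 4 : ℝ) • z t := by
      rw [iterates_succ]; abel
    simp only [he]
    rw [e1]
    refine (norm_add_le _ _).trans ?_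
    gcongr
    rw [norm_smul]
    have := hz t
    norm_num
    linarith
  have h0 : e 0 ≤ 1 := by simpa [he, iterates_zero] using hθs
  have hcrude : ∀ t : Fin (T + 1), e t ≤ 1 + (t : ℕ) * (g + N) := by
    intro t
    induction t using Fin.induction with
    | zero => simpa using h0
    | succ t ih =>
      have h1 := hsucc t
      have h2 := (hstep (iterates D γ (1 / 4) 0 z t.castSucc)).1
      simp only [Fin.val_castSucc, Fin.val_succ, Nat.cast_add, Nat.cast_one] at ih ⊢
      have h3 : ‖iterates D γ (1 / 4) 0 z t.castSucc - θs‖ ≤ 1 + (t : ℕ) * (g + N) := ih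
      linarith
  have hQ : ∀ t : Fin (T + 1), ((t : ℕ) : ℝ) * (g + N) ≤ T * (g + N) := fun t => by
    have : (t : ℕ) ≤ T := Nat.lt_succ_iff.1 t.2
    gcongr
  have hTQ : 0 ≤ (T : ℝ) * (g + N) := by positivity
  change e (Fin.last T) ≤ _
  -- If the total error is at most `1`, every iterate stays within distance `2`, and `128 * 2 = 256`
  -- is inside the contraction region. Otherwise the initial distance `1` is itself below the total
  -- error, which explains the factor `2` in the conclusion.
  rcases le_or_gt ((T : ℝ) * (g + N)) 1 with hsmall | hlarge
  · have hfine : ∀ t : Fin (T + 1), e t ≤ (1 - 1 / 1024) ^ (t : ℕ) + (t : ℕ) * (g + N) := by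
      intro t
      induction t using Fin.induction with
      | zero => simpa using h0
      | succ t ih =>
        have h1 := hsucc t
        have h2 : e t.castSucc ≤ 2 :=
          (hcrude t.castSucc).trans (by linarith [hQ t.castSucc])
        have h3 := (hstep (iterates D γ (1 / 4) 0 z t.castSucc)).2 (by
          change 128 * e t.castSucc ≤ _
          linarith)
        simp only [Fin.val_castSucc, Fin.val_succ, Nat.cast_add, Nat.cast_one] at ih ⊢
        have h4 : ‖iterates D γ (1 / 4) 0 z t.castSucc - θs‖ ≤
          (1 - 1 / 1024) ^ (t : ℕ) + (t : ℕ) * (g + N) := ih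
        have h5 : 0 ≤ ((t : ℕ) : ℝ) * (g + N) := by positivity
        rw [pow_succ]
        linarith
    have := hfine (Fin.last T)
    rw [Fin.val_last] at this
    linarith
  · have := hcrude (Fin.last T)
    rw [Fin.val_last] at this
    have : (0 : ℝ) ≤ (1 - 1 / 1024) ^ T := by positivity
    linarith

/-! ### Nets on the sphere and uniform conditioning -/

/-- A volume bound for separated subsets of the unit ball. -/
theorem card_le_of_separated_unitBall {p : ℕ} (s : Finset (Vec p)) (hs : ∀ c ∈ s, ‖c‖ ≤ 1)
    (h : ∀ c ∈ s, ∀ d ∈ s, c ≠ d → 1 / 16 < ‖c - d‖) : s.card ≤ 33 ^ p := by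
  let μ : Measure (Vec p) := Measure.addHaar
  have D : Set.Pairwise (s : Set (Vec p))
      (Function.onFun Disjoint fun c => Metric.ball (c : Vec p) (1 / 32)) := by
    intro c hc d hd hcd
    refine Metric.ball_disjoint_ball ?_
    rw [dist_eq_norm]
    linarith [h c hc d hd hcd]
  have hsub : (⋃ c ∈ s, Metric.ball (c : Vec p) (1 / 32)) ⊆ Metric.ball (0 : Vec p) (33 / 32) := by
    refine Set.iUnion₂_subset fun x hx => Metric.ball_subset_ball' ?_
    rw [dist_zero_right]
    linarith [hs x hx]
  have I : (s.card : ℝ≥0∞) * ENNReal.ofReal ((1 / 32) ^ p) * μ (Metric.ball 0 1) ≤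
      ENNReal.ofReal ((33 / 32) ^ p) * μ (Metric.ball 0 1) := by
    calc _ = μ (⋃ c ∈ s, Metric.ball (c : Vec p) (1 / 32)) := by
          rw [measure_biUnion_finset D fun c _ => measurableSet_ball]
          simp only [μ.addHaar_ball_of_pos _ (by norm_num : (0 : ℝ) < 1 / 32)]
          simp [mul_assoc]
      _ ≤ μ (Metric.ball (0 : Vec p) (33 / 32)) := measure_mono hsub
      _ = _ := by
          rw [μ.addHaar_ball_of_pos _ (by norm_num : (0 : ℝ) < 33 / 32)]
          simp
  have J : (s.card : ℝ≥0∞) * ENNReal.ofReal ((1 / 32) ^ p) ≤ ENNReal.ofReal ((33 / 32) ^ p) :=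
    (ENNReal.mul_le_mul_iff_left (Metric.measure_ball_pos _ _ zero_lt_one).ne'
      measure_ball_lt_top.ne).1 I
  have K : (s.card : ℝ) * (1 / 32) ^ p ≤ (33 / 32) ^ p := by
    have := ENNReal.toReal_le_of_le_ofReal (by positivity) J
    simpa using this
  have K2 : (s.card : ℝ) ≤ 33 ^ p := by
    have e : ((33 : ℝ) / 32) ^ p = 33 ^ p * (1 / 32) ^ p := by rw [← mul_pow]; norm_num
    rw [e] at K
    exact le_of_mul_le_mul_right K (by positivity)
  exact_mod_cast K2

/-- A separated subset of the sphere of largest cardinality is a net: an uncovered point could be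
added. The volume bound makes the maximum exist. -/
theorem exists_sphere_net (p : ℕ) :
    ∃ s : Finset (Vec p), s.card ≤ 33 ^ p ∧ (∀ c ∈ s, ‖c‖ = 1) ∧
      ∀ v : Vec p, ‖v‖ = 1 → ∃ c ∈ s, ‖v - c‖ ≤ 1 / 16 := by
  classical
  let P : ℕ → Prop := fun k => ∃ s : Finset (Vec p), s.card = k ∧ (∀ c ∈ s, ‖c‖ = 1) ∧
    ∀ c ∈ s, ∀ d ∈ s, c ≠ d → 1 / 16 < ‖c - d‖
  have hP0 : P 0 := ⟨∅, by simp⟩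
  obtain ⟨s, hcard, hs1, hsep⟩ := Nat.findGreatest_spec (P := P) (Nat.zero_le (33 ^ p)) hP0
  refine ⟨s, hcard ▸ Nat.findGreatest_le _, hs1, fun v hv => ?_⟩
  by_contra! hcon
  have hvs : v ∉ s := fun hmem => by
    have := hcon v hmem
    rw [sub_self, norm_zero] at this
    norm_num at this
  have hP : P (s.card + 1) := by
    refine ⟨insert v s, Finset.card_insert_of_notMem hvs, ?_, ?_⟩
    · simpa [hv] using hs1
    · intro c hc d hd hcd
      rw [Finset.mem_insert] at hc hd
      rcases hc with rfl | hc <;> rcases hd with rfl | hd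
      · exact absurd rfl hcd
      · exact hcon d hd
      · rw [norm_sub_rev]; exact hcon c hc
      · exact hsep c hc d hd hcd
  have hle : s.card + 1 ≤ 33 ^ p := by
    obtain ⟨t, ht, ht1, ht2⟩ := hP
    rw [← ht]
    exact card_le_of_separated_unitBall t (fun c hc => (ht1 c hc).le) ht2
  have := Nat.le_findGreatest hle hP
  omega

/-- For the operator `X u = (⟨x_i, u⟩)_i` the net gives `‖X‖ ≤ √(3n) + ‖X‖/16`, and `3 (16/15)² ≤
4`. -/
theorem sum_inner_sq_le_of_net {n p : ℕ} {x : Fin n → Vec p} {s : Finset (Vec p)}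
    (hs : ∀ v : Vec p, ‖v‖ = 1 → ∃ c ∈ s, ‖v - c‖ ≤ 1 / 16)
    (h : ∀ c ∈ s, ∑ i, inner ℝ (x i) c ^ 2 ≤ 3 * n) (u : Vec p) :
    ∑ i, inner ℝ (x i) u ^ 2 ≤ 4 * n * ‖u‖ ^ 2 := by
  let X₀ : Vec p →ₗ[ℝ] EuclideanSpace ℝ (Fin n) :=
    { toFun := fun u => WithLp.toLp 2 fun i => inner ℝ (x i) u
      map_add' := fun a b => by ext i; simp [inner_add_right]
      map_smul' := fun c a => by ext i; simp [inner_smul_right] }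
  let X := LinearMap.toContinuousLinearMap X₀
  have hX : ∀ u, ‖X u‖ ^ 2 = ∑ i, inner ℝ (x i) u ^ 2 := fun u => by
    rw [EuclideanSpace.real_norm_sq_eq]
    rfl
  have hop : ‖X‖ ≤ Real.sqrt (3 * n) + ‖X‖ / 16 := by
    refine X.opNorm_le_of_unit_norm (by positivity) fun v hv => ?_
    obtain ⟨c, hc, hvc⟩ := hs v hv
    have e : X v = X c + X (v - c) := by rw [← map_add]; congr 1; abel
    rw [e]
    refine (norm_add_le _ _).trans (add_le_add ?_ ?_)
    · exact Real.le_sqrt_of_sq_le (by rw [hX]; exact h c hc)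
    · refine (X.le_opNorm _).trans ?_
      nlinarith [norm_nonneg X]
  have hsq : ‖X‖ ^ 2 ≤ 4 * n := by
    have h1 : ‖X‖ ≤ 16 / 15 * Real.sqrt (3 * n) := by linarith
    have h2 := Real.sq_sqrt (by positivity : (0 : ℝ) ≤ 3 * n)
    have h3 : ‖X‖ ^ 2 ≤ (16 / 15 * Real.sqrt (3 * n)) ^ 2 := by gcongr
    rw [mul_pow, h2] at h3
    have : (0 : ℝ) ≤ n := by positivity
    linarith
  rw [← hX]
  calc _ ≤ (‖X‖ * ‖u‖) ^ 2 := by gcongr; exact X.le_opNorm u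
    _ ≤ _ := by rw [mul_pow]; gcongr

/-- By Cauchy–Schwarz and the quadratic upper bound, moving to the nearest net point costs at most
`√n · √(4n) / 16 = n/8`. -/
theorem sum_abs_inner_ge_of_net {n p : ℕ} {x : Fin n → Vec p} {s : Finset (Vec p)}
    (hs : ∀ v : Vec p, ‖v‖ = 1 → ∃ c ∈ s, ‖v - c‖ ≤ 1 / 16)
    (hx : ∀ u : Vec p, ∑ i, inner ℝ (x i) u ^ 2 ≤ 4 * n * ‖u‖ ^ 2)
    (h : ∀ c ∈ s, (n : ℝ) / 4 ≤ ∑ i, |inner ℝ (x i) c|) (u : Vec p) :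
    n * ‖u‖ / 8 ≤ ∑ i, |inner ℝ (x i) u| := by
  have hone : ∀ v : Vec p, ‖v‖ = 1 → (n : ℝ) / 8 ≤ ∑ i, |inner ℝ (x i) v| := by
    intro v hv
    obtain ⟨c, hc, hvc⟩ := hs v hv
    have h1 : ∑ i, |inner ℝ (x i) c| ≤
        ∑ i, |inner ℝ (x i) v| + ∑ i, |inner ℝ (x i) (v - c)| := by
      rw [← Finset.sum_add_distrib]
      refine Finset.sum_le_sum fun i _ => ?_
      have e : inner ℝ (x i) c = inner ℝ (x i) v - inner ℝ (x i) (v - c) := by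
        rw [inner_sub_right]; ring
      rw [e]
      exact abs_sub _ _
    have h2 : ∑ i, |inner ℝ (x i) (v - c)| ≤ n / 8 := by
      refine abs_le_of_sq_le_sq' ?_ (by positivity) |>.2
      have h3 := sq_sum_le_card_mul_sum_sq (s := (Finset.univ : Finset (Fin n)))
        (f := fun i => |inner ℝ (x i) (v - c)|)
      simp only [sq_abs, Finset.card_univ, Fintype.card_fin] at h3
      have h4 : ‖v - c‖ ^ 2 ≤ (1 / 16) ^ 2 := by gcongr
      calc _ ≤ (n : ℝ) * (4 * n * ‖v - c‖ ^ 2) := h3.trans (by gcongr; exact hx _)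
        _ ≤ (n : ℝ) * (4 * n * (1 / 16) ^ 2) := by gcongr
        _ = _ := by ring
    linarith [h c hc]
  rcases eq_or_ne u 0 with rfl | hu
  · simp
  have hu0 : 0 < ‖u‖ := norm_pos_iff.2 hu
  have := hone (‖u‖⁻¹ • u) (by rw [norm_smul, norm_inv, norm_norm, inv_mul_cancel₀ hu0.ne'])
  simp only [inner_smul_right, abs_mul, abs_inv, abs_norm, ← Finset.mul_sum] at this
  rw [inv_mul_eq_div, le_div_iff₀ hu0] at this
  linarith

/-! ### Exponential moments and Gaussian tails -/

/-- The exponential Markov inequality for a sum over independent coordinates. -/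
theorem pi_sum_ge_le {α : Type*} [MeasurableSpace α] (μ : Measure α) [IsProbabilityMeasure μ]
    {f : α → ℝ} (hf : Measurable f) (n : ℕ) {K : ℝ} (t : ℝ)
    (h : ∫⁻ a, ENNReal.ofReal (Real.exp (f a)) ∂μ ≤ ENNReal.ofReal (Real.exp K)) :
    Measure.pi (fun _ : Fin n => μ) {D | t ≤ ∑ i, f (D i)} ≤
      ENNReal.ofReal (Real.exp (n * K - t)) := by
  have h1 : ∫⁻ D, ENNReal.ofReal (Real.exp (∑ i, f (D i))) ∂Measure.pi (fun _ : Fin n => μ) ≤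
      ENNReal.ofReal (Real.exp (n * K)) := by
    simp_rw [Real.exp_sum, ENNReal.ofReal_prod_of_nonneg (fun _ _ => (Real.exp_pos _).le)]
    rw [lintegral_pi_prod (fun _ : Fin n => μ) (fun _ a => ENNReal.ofReal (Real.exp (f a)))
      (fun _ => by fun_prop), Finset.prod_const, Finset.card_univ, Fintype.card_fin,
      Real.exp_nat_mul, ENNReal.ofReal_pow (Real.exp_pos _).le]
    gcongr
  have hm : Measurable fun D : Fin n → α => ENNReal.ofReal (Real.exp (∑ i, f (D i))) := by
    fun_prop
  have h2 := meas_ge_le_lintegral_div (μ := Measure.pi (fun _ : Fin n => μ)) hm.aemeasurable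
    (ε := ENNReal.ofReal (Real.exp t)) (by simp [Real.exp_pos]) ENNReal.ofReal_ne_top
  have e : {D : Fin n → α | ENNReal.ofReal (Real.exp t) ≤
      ENNReal.ofReal (Real.exp (∑ i, f (D i)))} = {D | t ≤ ∑ i, f (D i)} := by
    ext D
    simp [ENNReal.ofReal_le_ofReal_iff (Real.exp_pos _).le]
  rw [e] at h2
  refine h2.trans ((ENNReal.div_le_div_right h1 _).trans (le_of_eq ?_))
  rw [← ENNReal.ofReal_div_of_pos (Real.exp_pos _), Real.exp_sub]

theorem lintegral_gaussianReal_eq {f : ℝ → ℝ≥0∞} (hf : Measurable f) :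
    ∫⁻ x, f x ∂gaussianReal 0 1 =
      ∫⁻ x, ENNReal.ofReal ((Real.sqrt (2 * Real.pi))⁻¹ * Real.exp (-x ^ 2 / 2)) * f x := by
  rw [gaussianReal_of_var_ne_zero _ one_ne_zero,
    lintegral_withDensity_eq_lintegral_mul _ (by fun_prop) hf]
  refine lintegral_congr fun x => ?_
  simp [gaussianPDF, gaussianPDFReal]

theorem lintegral_exp_sq_div_four_gaussianReal :
    ∫⁻ x, ENNReal.ofReal (Real.exp (x ^ 2 / 4)) ∂gaussianReal 0 1 =
      ENNReal.ofReal (Real.sqrt 2) := by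
  rw [lintegral_gaussianReal_eq (by fun_prop)]
  have e : ∀ x : ℝ, ENNReal.ofReal ((Real.sqrt (2 * Real.pi))⁻¹ * Real.exp (-x ^ 2 / 2)) *
      ENNReal.ofReal (Real.exp (x ^ 2 / 4)) =
      ENNReal.ofReal ((Real.sqrt (2 * Real.pi))⁻¹ * Real.exp (-(1 / 4) * x ^ 2)) := by
    intro x
    rw [← ENNReal.ofReal_mul (by positivity), mul_assoc, ← Real.exp_add]
    congr 3
    ring
  simp_rw [e]
  rw [← ofReal_integral_eq_lintegral_ofReal
    ((integrable_exp_neg_mul_sq (by norm_num)).const_mul _)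
    (Filter.Eventually.of_forall fun x => by positivity), integral_const_mul, integral_gaussian]
  congr 1
  rw [inv_mul_eq_div, ← Real.sqrt_div (by positivity)]
  congr 1
  field_simp
  norm_num

theorem sqrt_two_le_exp : Real.sqrt 2 ≤ Real.exp (7 / 20) := by
  rw [← Real.log_le_iff_le_exp (by positivity), Real.log_sqrt (by norm_num)]
  linarith [Real.log_two_lt_d9]

/-- The Gaussian density is at most `1/√(2π)` and `exp (-2|x|)` has integral `1`, so the claim
reduces to `exp (9/5) ≤ 2π`. -/
theorem lintegral_exp_neg_abs_gaussianReal_le :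
    ∫⁻ x, ENNReal.ofReal (Real.exp (-2 * |x|)) ∂gaussianReal 0 1 ≤
      ENNReal.ofReal (Real.exp (-(9 / 10))) := by
  rw [lintegral_gaussianReal_eq (by fun_prop)]
  have hint : Integrable fun x : ℝ => Real.exp (-2 * |x|) := by
    rw [← integrableOn_univ, ← Set.Iic_union_Ioi (a := (0 : ℝ))]
    refine IntegrableOn.union ?_ ?_
    · refine (integrableOn_exp_mul_Iic (by norm_num : (0 : ℝ) < 2) 0).congr_fun
        (fun x hx => ?_) measurableSet_Iic
      rw [abs_of_nonpos hx]
      ring_nf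
    · refine (integrableOn_exp_mul_Ioi (by norm_num : (-2 : ℝ) < 0) 0).congr_fun
        (fun x hx => ?_) measurableSet_Ioi
      rw [abs_of_pos hx]
  have hval : ∫ x : ℝ, Real.exp (-2 * |x|) = 1 := by
    rw [integral_comp_abs (f := fun x => Real.exp (-2 * x)), integral_exp_mul_Ioi (by norm_num)]
    norm_num
  have hpi : (Real.sqrt (2 * Real.pi))⁻¹ ≤ Real.exp (-(9 / 10)) := by
    rw [Real.exp_neg]
    refine inv_anti₀ (Real.exp_pos _) (Real.le_sqrt_of_sq_le ?_)
    have h1 : Real.exp (9 / 10) ^ 2 ≤ 6.28 := by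
      refine le_of_pow_le_pow_left₀ (n := 5) (by norm_num) (by norm_num) ?_
      have e : (Real.exp (9 / 10) ^ 2) ^ 5 = Real.exp 1 ^ 9 := by
        rw [← pow_mul, ← Real.exp_nat_mul, ← Real.exp_nat_mul]
        norm_num
      rw [e]
      calc Real.exp 1 ^ 9 ≤ 2.7182818286 ^ 9 := by
            gcongr
            exact Real.exp_one_lt_d9.le
        _ ≤ _ := by norm_num
    linarith [Real.pi_gt_d2]
  calc _ ≤ ∫⁻ x : ℝ, ENNReal.ofReal ((Real.sqrt (2 * Real.pi))⁻¹ * Real.exp (-2 * |x|)) := by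
        refine lintegral_mono fun x => ?_
        rw [← ENNReal.ofReal_mul (by positivity), mul_assoc, ← Real.exp_add]
        refine ENNReal.ofReal_le_ofReal ?_
        gcongr
        nlinarith [sq_nonneg x]
    _ = ENNReal.ofReal ((Real.sqrt (2 * Real.pi))⁻¹) := by
        rw [← ofReal_integral_eq_lintegral_ofReal (hint.const_mul _)
          (Filter.Eventually.of_forall fun x => by positivity), integral_const_mul, hval, mul_one]
    _ ≤ _ := ENNReal.ofReal_le_ofReal hpi

theorem gaussianReal_sq_ge_le (s : ℝ) :
    gaussianReal 0 1 {x | s ≤ x ^ 2} ≤ ENNReal.ofReal (Real.exp (7 / 20 - s / 4)) := by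
  have h2 := meas_ge_le_lintegral_div (μ := gaussianReal 0 1)
    (f := fun x => ENNReal.ofReal (Real.exp (x ^ 2 / 4))) (by fun_prop)
    (ε := ENNReal.ofReal (Real.exp (s / 4))) (by simp [Real.exp_pos]) ENNReal.ofReal_ne_top
  have e : {x : ℝ | ENNReal.ofReal (Real.exp (s / 4)) ≤ ENNReal.ofReal (Real.exp (x ^ 2 / 4))} =
      {x | s ≤ x ^ 2} := by
    ext x
    simp [ENNReal.ofReal_le_ofReal_iff (Real.exp_pos _).le, div_le_div_iff_of_pos_right]
  rw [e, lintegral_exp_sq_div_four_gaussianReal, ← ENNReal.ofReal_div_of_pos (Real.exp_pos _)] at h2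
  refine h2.trans (ENNReal.ofReal_le_ofReal ?_)
  rw [Real.exp_sub]
  gcongr
  exact sqrt_two_le_exp

theorem stdGaussian_map_inner {p : ℕ} {v : Vec p} (hv : ‖v‖ = 1) :
    (stdGaussian (Vec p)).map (fun x => inner ℝ x v) = gaussianReal 0 1 := by
  have h := IsGaussian.map_eq_gaussianReal (μ := stdGaussian (Vec p)) (innerSL ℝ v)
  rw [integral_strongDual_stdGaussian, variance_dual_stdGaussian, innerSL_apply_norm, hv] at h
  simp only [one_pow, Real.toNNReal_one] at h
  rw [← h]
  congr 1
  ext x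
  simp [real_inner_comm]

/-- The law of one observation `(x, y)` in the Gaussian generative model. -/
noncomputable def exampleLaw (p : ℕ) (θ : Vec p) (σ : ℝ) : Measure (Vec p × ℝ) :=
  ((stdGaussian (Vec p)).prod (gaussianReal 0 (σ ^ 2).toNNReal)).map
    (fun q : Vec p × ℝ => (q.1, inner ℝ q.1 θ + q.2))

theorem dataLaw_eq_pi (n p : ℕ) (θ : Vec p) (σ : ℝ) :
    dataLaw n p θ σ = Measure.pi fun _ : Fin n => exampleLaw p θ σ := rfl

instance isProbabilityMeasure_exampleLaw (p : ℕ) (θ : Vec p) (σ : ℝ) :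
    IsProbabilityMeasure (exampleLaw p θ σ) :=
  Measure.isProbabilityMeasure_map (by fun_prop)

instance isProbabilityMeasure_dataLaw (n p : ℕ) (θ : Vec p) (σ : ℝ) :
    IsProbabilityMeasure (dataLaw n p θ σ) := by
  rw [dataLaw_eq_pi]; infer_instance

theorem exampleLaw_map_inner {p : ℕ} (θ : Vec p) (σ : ℝ) {v : Vec p} (hv : ‖v‖ = 1) :
    (exampleLaw p θ σ).map (fun q => inner ℝ q.1 v) = gaussianReal 0 1 := by
  rw [exampleLaw, Measure.map_map (by fun_prop) (by fun_prop), ← stdGaussian_map_inner hv]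
  have : (fun q : Vec p × ℝ => (inner ℝ q.1 v : ℝ)) ∘
      (fun q : Vec p × ℝ => (q.1, inner ℝ q.1 θ + q.2)) = (fun x => inner ℝ x v) ∘ Prod.fst := rfl
  rw [this, ← Measure.map_map (by fun_prop) measurable_fst, Measure.map_fst_prod, measure_univ,
    one_smul]

theorem gaussianReal_map_div {σ : ℝ} (hσ : 0 < σ) :
    (gaussianReal 0 (σ ^ 2).toNNReal).map (fun x => x / σ) = gaussianReal 0 1 := by
  rw [gaussianReal_map_div_const]
  congr 1
  · simp
  · ext
    have : (0 : ℝ) ≤ σ ^ 2 := by positivity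
    simp [this, hσ.ne']

theorem exampleLaw_map_residual {p : ℕ} (θ : Vec p) {σ : ℝ} (hσ : 0 < σ) :
    (exampleLaw p θ σ).map (fun q => (q.2 - inner ℝ q.1 θ) / σ) = gaussianReal 0 1 := by
  rw [exampleLaw, Measure.map_map (by fun_prop) (by fun_prop), ← gaussianReal_map_div hσ]
  have : (fun q : Vec p × ℝ => (q.2 - inner ℝ q.1 θ) / σ) ∘
      (fun q : Vec p × ℝ => (q.1, inner ℝ q.1 θ + q.2)) = (fun x => x / σ) ∘ Prod.snd := by
    ext q; simp
  rw [this, ← Measure.map_map (by fun_prop) measurable_snd, Measure.map_snd_prod, measure_univ,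
    one_smul]

theorem sphericalGaussian_map_inner {p : ℕ} {lam : ℝ} (hlam : lam ≠ 0) {v : Vec p}
    (hv : ‖v‖ = 1) :
    (sphericalGaussian p lam).map (fun z => inner ℝ z v / lam) = gaussianReal 0 1 := by
  rw [sphericalGaussian, Measure.map_map (by fun_prop) (by fun_prop), ← stdGaussian_map_inner hv]
  congr 1
  ext z
  simp [inner_smul_left, hlam]

theorem pi_eval_sq_ge_le {α : Type*} [MeasurableSpace α] (μ : Measure α) [IsProbabilityMeasure μ]
    {f : α → ℝ} (hf : Measurable f) (h : μ.map f = gaussianReal 0 1) {n : ℕ} (i : Fin n) (s : ℝ) :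
    Measure.pi (fun _ : Fin n => μ) {D | s ≤ f (D i) ^ 2} ≤
      ENNReal.ofReal (Real.exp (7 / 20 - s / 4)) := by
  have hm : MeasurableSet {a : ℝ | s ≤ a ^ 2} := measurableSet_le measurable_const (by fun_prop)
  refine le_trans (le_of_eq ?_) (gaussianReal_sq_ge_le s)
  rw [← h, Measure.map_apply hf hm]
  exact (measurePreserving_eval (fun _ : Fin n => μ) i).measure_preimage
    (hf hm).nullMeasurableSet

theorem lintegral_exp_mul_gaussianReal (a σ : ℝ) :
    ∫⁻ y, ENNReal.ofReal (Real.exp (a * y)) ∂gaussianReal 0 (σ ^ 2).toNNReal =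
      ENNReal.ofReal (Real.exp (a ^ 2 * σ ^ 2 / 2)) := by
  rw [← ofReal_integral_eq_lintegral_ofReal (integrable_exp_mul_gaussianReal a)
    (Filter.Eventually.of_forall fun x => by positivity)]
  have := congrFun (mgf_fun_id_gaussianReal (μ := 0) (v := (σ ^ 2).toNNReal)) a
  rw [mgf] at this
  rw [this, Real.coe_toNNReal _ (by positivity)]
  congr 2
  ring

/-- Given `x`, the residual is Gaussian, so integrating it out leaves `exp (⟨x, v⟩² / (4n))`. The
scale of `s` keeps the product over `n` examples at most `exp (1/2)`. -/
theorem lintegral_exp_residual_mul_inner_le {n p : ℕ} (hn : 0 < n) (θ : Vec p) {σ : ℝ}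
    {s : ℝ} (hs : s ^ 2 * σ ^ 2 = 1 / (2 * n)) {v : Vec p} (hv : ‖v‖ = 1) :
    ∫⁻ q, ENNReal.ofReal (Real.exp (s * ((q.2 - inner ℝ q.1 θ) * inner ℝ q.1 v)))
      ∂exampleLaw p θ σ ≤ ENNReal.ofReal (Real.exp (1 / (2 * n))) := by
  have hn' : (1 : ℝ) ≤ n := by exact_mod_cast hn
  rw [exampleLaw, lintegral_map (by fun_prop) (by fun_prop), lintegral_prod _ (by fun_prop)]
  have h1 : ∀ x : Vec p, ∫⁻ y, ENNReal.ofReal (Real.exp (s * ((inner ℝ x θ + y - inner ℝ x θ) *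
      inner ℝ x v))) ∂gaussianReal 0 (σ ^ 2).toNNReal =
      ENNReal.ofReal (Real.exp ((inner ℝ x v) ^ 2 / 4 / n)) := by
    intro x
    have := lintegral_exp_mul_gaussianReal (s * inner ℝ x v) σ
    rw [show (s * inner ℝ x v) ^ 2 * σ ^ 2 / 2 = (s ^ 2 * σ ^ 2) * (inner ℝ x v) ^ 2 / 2 by ring,
      hs] at this
    convert this using 3
    · congr 1
      ring_nf
    · ring
  simp_rw [h1]
  have h2 : ∫⁻ x, ENNReal.ofReal (Real.exp ((inner ℝ x v) ^ 2 / 4 / n)) ∂stdGaussian (Vec p) =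
      ∫⁻ a, ENNReal.ofReal (Real.exp (a ^ 2 / 4 / n)) ∂gaussianReal 0 1 := by
    rw [← stdGaussian_map_inner hv, lintegral_map (by fun_prop) (by fun_prop)]
  rw [h2]
  have hinv : (n : ℝ)⁻¹ ≤ 1 := inv_le_one_of_one_le₀ hn'
  have hinv0 : (0 : ℝ) ≤ (n : ℝ)⁻¹ := by positivity
  -- Convexity of `exp` between `0` and `a²/4` reduces to the known moment `√2`, giving `1 + (√2 -
  -- 1)/n`.
  have h3 : ∀ a : ℝ, Real.exp (a ^ 2 / 4 / n) ≤
      (1 - (n : ℝ)⁻¹) + (n : ℝ)⁻¹ * Real.exp (a ^ 2 / 4) := by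
    intro a
    have := convexOn_exp.2 (Set.mem_univ (0 : ℝ)) (Set.mem_univ (a ^ 2 / 4))
      (sub_nonneg.2 hinv) hinv0 (by ring)
    simp only [smul_eq_mul, mul_zero, zero_add, Real.exp_zero, mul_one] at this
    rwa [div_eq_inv_mul (a ^ 2 / 4)]
  calc _ ≤ ∫⁻ a, (ENNReal.ofReal (1 - (n : ℝ)⁻¹) +
          ENNReal.ofReal (n : ℝ)⁻¹ * ENNReal.ofReal (Real.exp (a ^ 2 / 4))) ∂gaussianReal 0 1 := by
        refine lintegral_mono fun a => ?_
        rw [← ENNReal.ofReal_mul hinv0, ← ENNReal.ofReal_add (sub_nonneg.2 hinv) (by positivity)]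
        exact ENNReal.ofReal_le_ofReal (h3 a)
    _ = ENNReal.ofReal (1 - (n : ℝ)⁻¹ + (n : ℝ)⁻¹ * Real.sqrt 2) := by
        rw [lintegral_add_left measurable_const, lintegral_const_mul _ (by fun_prop),
          lintegral_exp_sq_div_four_gaussianReal, lintegral_const, measure_univ, mul_one,
          ← ENNReal.ofReal_mul hinv0, ← ENNReal.ofReal_add (sub_nonneg.2 hinv) (by positivity)]
    _ ≤ _ := by
        refine ENNReal.ofReal_le_ofReal ?_
        have h4 : Real.sqrt 2 ≤ 3 / 2 := Real.sqrt_le_iff.2 (by norm_num)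
        have h5 := Real.add_one_le_exp (1 / (2 * (n : ℝ)))
        have h6 : 1 / (2 * (n : ℝ)) = (n : ℝ)⁻¹ * (1 / 2) := by field_simp
        nlinarith

theorem measure_exists_le_card_mul {Ω ι : Type*} [MeasurableSpace Ω] (μ : Measure Ω)
    (s : Finset ι) {A : ι → Set Ω} {b : ℝ} (hb : ∀ i ∈ s, μ (A i) ≤ ENNReal.ofReal b) :
    μ {ω | ∃ i ∈ s, ω ∈ A i} ≤ ENNReal.ofReal (s.card * b) := by
  have e : {ω | ∃ i ∈ s, ω ∈ A i} = ⋃ i ∈ s, A i := by ext; simp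
  rw [e]
  calc _ ≤ ∑ i ∈ s, μ (A i) := measure_biUnion_finset_le _ _
    _ ≤ ∑ _i ∈ s, ENNReal.ofReal b := Finset.sum_le_sum hb
    _ = _ := by
      rw [Finset.sum_const, nsmul_eq_mul, ENNReal.ofReal_mul (by positivity)]
      simp

theorem norm_le_of_abs_coord_le {p : ℕ} {x : Vec p} {t : ℝ} (ht : 0 ≤ t)
    (h : ∀ j, |inner ℝ x (EuclideanSpace.single j 1)| ≤ t) : ‖x‖ ≤ t * Real.sqrt p := by
  rw [← Real.sqrt_sq ht, ← Real.sqrt_mul (sq_nonneg t)]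
  refine Real.le_sqrt_of_sq_le ?_
  rw [EuclideanSpace.real_norm_sq_eq]
  calc _ ≤ ∑ _j : Fin p, t ^ 2 := by
        refine Finset.sum_le_sum fun j _ => ?_
        have := h j
        rw [EuclideanSpace.inner_single_right] at this
        rw [← sq_abs]
        gcongr
        simpa using this
    _ = _ := by simp; ring

theorem norm_single_one {p : ℕ} (j : Fin p) :
    ‖(EuclideanSpace.single j 1 : Vec p)‖ = 1 := by simp

/-! ### Probabilities of the bad events -/

/-- Union bound over the net. Both tails have the same exponent: `7/20 - 3/4 = -9/10 + 1/2 = -2/5`.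
-/
theorem dataLaw_ill_conditioned_le {n p : ℕ} (θ : Vec p) (σ : ℝ) :
    dataLaw n p θ σ {D | ¬((∀ u : Vec p, ∑ i, inner ℝ (D i).1 u ^ 2 ≤ 4 * n * ‖u‖ ^ 2) ∧
      ∀ u : Vec p, n * ‖u‖ / 8 ≤ ∑ i, |inner ℝ (D i).1 u|)} ≤
      ENNReal.ofReal (33 ^ p * (2 * Real.exp (-(2 / 5) * n))) := by
  obtain ⟨s, hcard, hs1, hs⟩ := exists_sphere_net p
  rw [dataLaw_eq_pi]
  have hsq : ∀ c ∈ s, Measure.pi (fun _ : Fin n => exampleLaw p θ σ)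
      {D | (3 * n : ℝ) / 4 ≤ ∑ i, inner ℝ (D i).1 c ^ 2 / 4} ≤
      ENNReal.ofReal (Real.exp (-(2 / 5) * n)) := by
    intro c hc
    have h := pi_sum_ge_le (exampleLaw p θ σ) (f := fun q => inner ℝ q.1 c ^ 2 / 4) (by fun_prop)
      n (K := 7 / 20) (3 * n / 4) (by
        have := lintegral_exp_sq_div_four_gaussianReal
        rw [← exampleLaw_map_inner θ σ (hs1 c hc),
          lintegral_map (by fun_prop) (by fun_prop)] at this
        rw [this]
        exact ENNReal.ofReal_le_ofReal sqrt_two_le_exp)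
    refine h.trans (le_of_eq ?_)
    congr 2; ring
  have habs : ∀ c ∈ s, Measure.pi (fun _ : Fin n => exampleLaw p θ σ)
      {D | -(n / 2 : ℝ) ≤ ∑ i, -2 * |inner ℝ (D i).1 c|} ≤
      ENNReal.ofReal (Real.exp (-(2 / 5) * n)) := by
    intro c hc
    have h := pi_sum_ge_le (exampleLaw p θ σ) (f := fun q => -2 * |inner ℝ q.1 c|) (by fun_prop)
      n (K := -(9 / 10)) (-(n / 2)) (by
        have := lintegral_exp_neg_abs_gaussianReal_le
        rwa [← exampleLaw_map_inner θ σ (hs1 c hc),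
          lintegral_map (by fun_prop) (by fun_prop)] at this)
    refine h.trans (le_of_eq ?_)
    congr 2; ring
  have hunion : ∀ c ∈ s, Measure.pi (fun _ : Fin n => exampleLaw p θ σ)
      ({D | (3 * n : ℝ) / 4 ≤ ∑ i, inner ℝ (D i).1 c ^ 2 / 4} ∪
        {D | -(n / 2 : ℝ) ≤ ∑ i, -2 * |inner ℝ (D i).1 c|}) ≤
      ENNReal.ofReal (2 * Real.exp (-(2 / 5) * n)) := by
    intro c hc
    refine (measure_union_le _ _).trans ((add_le_add (hsq c hc) (habs c hc)).trans (le_of_eq ?_))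
    rw [← ENNReal.ofReal_add (by positivity) (by positivity), two_mul]
  refine le_trans (measure_mono fun D hD => ?_)
    ((measure_exists_le_card_mul _ s hunion).trans (ENNReal.ofReal_le_ofReal ?_))
  · by_contra hcon
    refine hD ?_
    simp only [Set.mem_ofPred_eq, Set.mem_union, not_exists, not_and, not_or, not_le,
      ← Finset.sum_div, ← Finset.mul_sum] at hcon
    have h1 := sum_inner_sq_le_of_net (x := fun i => (D i).1) hs
      (fun c hc => by linarith [(hcon c hc).1])
    exact ⟨h1, sum_abs_inner_ge_of_net (x := fun i => (D i).1) hs h1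
      (fun c hc => by linarith [(hcon c hc).2])⟩
  · gcongr
    exact_mod_cast hcard

theorem dataLaw_norm_feature_gt_le {n p : ℕ} (θ : Vec p) (σ : ℝ) {L : ℝ} (hL : 1 ≤ L) :
    dataLaw n p θ σ {D | ¬∀ i, ‖(D i).1‖ ≤ 4 * L * Real.sqrt p} ≤
      ENNReal.ofReal (n * p * Real.exp (7 / 20 - 4 * L)) := by
  rw [dataLaw_eq_pi]
  refine le_trans (measure_mono fun D hD => ?_) ((measure_exists_le_card_mul _ Finset.univ
    (A := fun q : Fin n × Fin p =>
      {D | 16 * L ≤ inner ℝ (D q.1).1 (EuclideanSpace.single q.2 1) ^ 2})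
    (b := Real.exp (7 / 20 - 4 * L)) fun q _ => ?_).trans (le_of_eq ?_))
  · by_contra hcon
    refine hD fun i => norm_le_of_abs_coord_le (by linarith) fun j => ?_
    simp only [Set.mem_ofPred_eq, not_exists, not_and, not_le] at hcon
    have := hcon (i, j) (Finset.mem_univ _)
    exact abs_le_of_sq_le_sq (by nlinarith) (by linarith)
  · refine (pi_eval_sq_ge_le (exampleLaw p θ σ) (by fun_prop)
      (exampleLaw_map_inner θ σ (norm_single_one q.2)) q.1 (16 * L)).trans (le_of_eq ?_)
    congr 2; ring
  · simp

theorem dataLaw_residual_gt_le {n p : ℕ} (θ : Vec p) {σ : ℝ} (hσ : 0 < σ) {L : ℝ} (hL : 1 ≤ L) :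
    dataLaw n p θ σ {D | ¬∀ i, |(D i).2 - inner ℝ (D i).1 θ| ≤ 4 * L * σ} ≤
      ENNReal.ofReal (n * Real.exp (7 / 20 - 4 * L)) := by
  rw [dataLaw_eq_pi]
  refine le_trans (measure_mono fun D hD => ?_) ((measure_exists_le_card_mul _ Finset.univ
    (A := fun i : Fin n => {D | 16 * L ≤ (((D i).2 - inner ℝ (D i).1 θ) / σ) ^ 2})
    (b := Real.exp (7 / 20 - 4 * L)) fun i _ => ?_).trans (le_of_eq ?_))
  · by_contra hcon
    refine hD fun i => ?_
    simp only [Set.mem_ofPred_eq, not_exists, not_and, not_le] at hcon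
    have h1 := hcon i (Finset.mem_univ _)
    have h2 : |((D i).2 - inner ℝ (D i).1 θ) / σ| ≤ 4 * L :=
      abs_le_of_sq_le_sq (by nlinarith) (by linarith)
    rwa [abs_div, abs_of_pos hσ, div_le_iff₀ hσ] at h2
  · refine (pi_eval_sq_ge_le (exampleLaw p θ σ) (by fun_prop)
      (exampleLaw_map_residual θ hσ) i (16 * L)).trans (le_of_eq ?_)
    congr 2; ring
  · simp

theorem dataLaw_noise_correlation_gt_le {n p : ℕ} (hn : 0 < n) (θ : Vec p) {σ : ℝ} (hσ : 0 < σ)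
    {L : ℝ} (hL : 1 ≤ L) :
    dataLaw n p θ σ {D | ¬‖∑ i, ((D i).2 - inner ℝ (D i).1 θ) • (D i).1‖ ≤
      6 * L * σ * Real.sqrt n * Real.sqrt p} ≤
      ENNReal.ofReal (p * (2 * Real.exp (1 / 2 - 4 * L))) := by
  have hn' : (0 : ℝ) < n := by exact_mod_cast hn
  rw [dataLaw_eq_pi]
  set s : ℝ := (σ * Real.sqrt (2 * n))⁻¹ with hs
  have hs0 : 0 < s := by positivity
  have hs2 : s ^ 2 * σ ^ 2 = 1 / (2 * n) := by
    rw [hs, inv_pow, mul_pow, Real.sq_sqrt (by positivity)]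
    field_simp
  -- The factor `6` is chosen so that `6/√2 ≥ 4`.
  have hst : 4 * L ≤ s * (6 * L * σ * Real.sqrt n) := by
    have e : s * (6 * L * σ * Real.sqrt n) = 6 * L / Real.sqrt 2 := by
      rw [hs, Real.sqrt_mul (by norm_num)]
      have : Real.sqrt n ≠ 0 := by positivity
      field_simp
    rw [e, le_div_iff₀ (by positivity)]
    have : Real.sqrt 2 ≤ 3 / 2 := Real.sqrt_le_iff.2 (by norm_num)
    nlinarith
  have hmain : ∀ r : ℝ, r ^ 2 * σ ^ 2 = 1 / (2 * n) → ∀ j : Fin p,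
      Measure.pi (fun _ : Fin n => exampleLaw p θ σ) {D | 4 * L ≤ ∑ i, r *
        (((D i).2 - inner ℝ (D i).1 θ) * inner ℝ (D i).1 (EuclideanSpace.single j 1))} ≤
      ENNReal.ofReal (Real.exp (1 / 2 - 4 * L)) := by
    intro r hr j
    refine (pi_sum_ge_le (exampleLaw p θ σ) (f := fun q => r * ((q.2 - inner ℝ q.1 θ) *
      inner ℝ q.1 (EuclideanSpace.single j 1))) (by fun_prop) n (4 * L)
      (lintegral_exp_residual_mul_inner_le hn θ hr (norm_single_one j))).trans (le_of_eq ?_)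
    congr 2; field_simp
  refine le_trans (measure_mono fun D hD => ?_) ((measure_exists_le_card_mul _ Finset.univ
    (A := fun j : Fin p => {D : Dataset n p | 4 * L ≤ ∑ i, s *
        (((D i).2 - inner ℝ (D i).1 θ) * inner ℝ (D i).1 (EuclideanSpace.single j 1))} ∪
      {D | 4 * L ≤ ∑ i, -s *
        (((D i).2 - inner ℝ (D i).1 θ) * inner ℝ (D i).1 (EuclideanSpace.single j 1))})
    (b := 2 * Real.exp (1 / 2 - 4 * L)) fun j _ => ?_).trans (le_of_eq ?_))
  · by_contra hcon
    refine hD (norm_le_of_abs_coord_le (by positivity) fun j => ?_)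
    simp only [Set.mem_ofPred_eq, Set.mem_union, not_exists, not_and, not_or, not_le,
      ← Finset.mul_sum] at hcon
    have h1 := hcon j (Finset.mem_univ _)
    rw [sum_inner]
    simp only [inner_smul_left, conj_trivial]
    generalize ∑ i, ((D i).2 - inner ℝ (D i).1 θ) *
      inner ℝ (D i).1 (EuclideanSpace.single j 1) = S at h1 ⊢
    rw [abs_le]
    constructor <;> nlinarith
  · refine (measure_union_le _ _).trans ((add_le_add (hmain s hs2 j)
      (hmain (-s) (by rw [neg_sq, hs2]) j)).trans (le_of_eq ?_))
    rw [← ENNReal.ofReal_add (by positivity) (by positivity), two_mul]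
  · simp

/-- The level `48 * L`, larger than for the data, leaves a spare exponential factor to pay for the
union over `T` steps; `48 L ≤ (7 L)²` because `L ≥ 1`. -/
theorem noiseLaw_norm_gt_le {p T : ℕ} {lam : ℝ} (hlam : 0 < lam) {L : ℝ} (hL : 1 ≤ L) :
    noiseLaw p T lam {z | ¬∀ t, ‖z t‖ ≤ 7 * L * lam * Real.sqrt p} ≤
      ENNReal.ofReal (T * p * Real.exp (7 / 20 - 12 * L)) := by
  unfold noiseLaw
  refine le_trans (measure_mono fun z hz => ?_) ((measure_exists_le_card_mul _ Finset.univ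
    (A := fun q : Fin T × Fin p =>
      {z | 48 * L ≤ (inner ℝ (z q.1) (EuclideanSpace.single q.2 1) / lam) ^ 2})
    (b := Real.exp (7 / 20 - 12 * L)) fun q _ => ?_).trans (le_of_eq ?_))
  · by_contra hcon
    refine hz fun t => norm_le_of_abs_coord_le (by positivity) fun j => ?_
    simp only [Set.mem_ofPred_eq, not_exists, not_and, not_le] at hcon
    have h1 := hcon (t, j) (Finset.mem_univ _)
    have h2 : |inner ℝ (z t) (EuclideanSpace.single j 1) / lam| ≤ 7 * L :=
      abs_le_of_sq_le_sq (by nlinarith) (by linarith)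
    rwa [abs_div, abs_of_pos hlam, div_le_iff₀ hlam] at h2
  · refine (pi_eval_sq_ge_le (sphericalGaussian p lam) (by fun_prop)
      (sphericalGaussian_map_inner hlam.ne' (norm_single_one q.2)) q.1 (48 * L)).trans
      (le_of_eq ?_)
    congr 2; ring
  · simp

/-! ### Numerical bounds: each bad event costs at most `β / 5` -/

section Numeric

variable {n p T β L : ℝ}

/-- The reason for the form of `L`: a factor `exp (-L)` pays for a union over `n` events and still
leaves a multiple of `β`. -/
theorem exp_neg_mul_eq (hn : 1 ≤ n) (hβ : 0 < β) (hL : L = 1 + Real.log (n / β)) :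
    n * Real.exp (-L) = β * Real.exp (-1) := by
  rw [hL, neg_add, Real.exp_add, Real.exp_neg (Real.log _), Real.exp_log (by positivity)]
  field_simp

theorem exp_neg_one_le : Real.exp (-1) ≤ 2 / 5 := by
  rw [Real.exp_neg, inv_le_comm₀ (Real.exp_pos _) (by norm_num)]
  linarith [Real.exp_one_gt_d9]

theorem exp_sub_le_pow (hL : 1 ≤ L) {r : ℝ} (hr : r ≤ 1) (k : ℕ) :
    Real.exp (r - (k + 1) * L) ≤ Real.exp (-L) * Real.exp 1 * Real.exp (-1) ^ k := by
  rw [← Real.exp_nat_mul, ← Real.exp_add, ← Real.exp_add]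
  refine Real.exp_le_exp.2 ?_
  have : (k : ℝ) * 1 ≤ k * L := by gcongr
  linarith

/-- Since `33 ≤ e⁴`, the net costs `4p`, while `2n/5 ≥ 8p + 8 log (1/β)`; the surplus gives `e⁻⁴ β`.
-/
theorem net_failure_le {n p : ℕ} (hp : 1 ≤ p) (hβ : 0 < β) (hβ1 : β < 1)
    (h : 20 * ((p : ℝ) + Real.log (1 / β)) ≤ n) :
    33 ^ p * (2 * Real.exp (-(2 / 5) * n)) ≤ β / 5 := by
  have hp' : (1 : ℝ) ≤ p := by exact_mod_cast hp
  have hlog : 0 < Real.log (1 / β) := Real.log_pos (by rw [lt_div_iff₀ hβ]; linarith)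
  have h1 : (33 : ℝ) ≤ Real.exp 1 ^ 4 := by
    calc (33 : ℝ) ≤ 2.7182818283 ^ 4 := by norm_num
      _ ≤ _ := by gcongr; exact Real.exp_one_gt_d9.le
  have h2 : (33 : ℝ) ^ p ≤ Real.exp (4 * p) := by
    calc (33 : ℝ) ^ p ≤ (Real.exp 1 ^ 4) ^ p := by gcongr
      _ = _ := by rw [← pow_mul, ← Real.exp_nat_mul]; push_cast; ring_nf
  have h3 : Real.exp (4 * p) * Real.exp (-(2 / 5) * n) ≤ Real.exp (-1) ^ 4 * β := by
    have e : β = Real.exp (-Real.log (1 / β)) := by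
      rw [one_div, Real.log_inv, neg_neg, Real.exp_log hβ]
    rw [← Real.exp_nat_mul, ← Real.exp_add]
    nth_rewrite 1 [e]
    rw [← Real.exp_add]
    refine Real.exp_le_exp.2 ?_
    push_cast
    linarith
  have h4 : Real.exp (-1) ^ 4 ≤ (2 / 5) ^ 4 := by gcongr; exact exp_neg_one_le
  have h5 : 33 ^ p * Real.exp (-(2 / 5) * n) ≤ Real.exp (4 * p) * Real.exp (-(2 / 5) * n) := by
    gcongr
  nlinarith

theorem feature_failure_le (hn : 1 ≤ n) (hp : p ≤ n) (hβ : 0 < β) (hβ1 : β < 1)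
    (hL : L = 1 + Real.log (n / β)) (hL1 : 1 ≤ L) :
    n * p * Real.exp (7 / 20 - 4 * L) ≤ β / 5 := by
  have h0 := exp_neg_mul_eq hn hβ hL
  have h1 : Real.exp (7 / 20 - 4 * L) ≤ Real.exp (-L) ^ 2 * (Real.exp 1 * Real.exp (-1) ^ 2) := by
    rw [← Real.exp_nat_mul, ← Real.exp_nat_mul, ← Real.exp_add, ← Real.exp_add]
    refine Real.exp_le_exp.2 ?_
    push_cast
    linarith
  have h2 : Real.exp 1 * Real.exp (-1) = 1 := by rw [← Real.exp_add]; simp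
  have h3 := exp_neg_one_le
  have h4 := Real.exp_pos (-1)
  calc _ ≤ n * n * (Real.exp (-L) ^ 2 * (Real.exp 1 * Real.exp (-1) ^ 2)) := by gcongr
    _ = (n * Real.exp (-L)) ^ 2 * (Real.exp 1 * Real.exp (-1)) * Real.exp (-1) := by ring
    _ = β ^ 2 * Real.exp (-1) ^ 3 := by rw [h0, h2]; ring
    _ ≤ β * (2 / 5) ^ 3 := by
        gcongr
        nlinarith
    _ ≤ β / 5 := by linarith

theorem residual_failure_le (hn : 1 ≤ n) (hβ : 0 < β)
    (hL : L = 1 + Real.log (n / β)) (hL1 : 1 ≤ L) :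
    n * Real.exp (7 / 20 - 4 * L) ≤ β / 5 := by
  have h0 := exp_neg_mul_eq hn hβ hL
  have h1 := exp_sub_le_pow hL1 (r := 7 / 20) (by norm_num) 3
  have h2 : Real.exp 1 * Real.exp (-1) = 1 := by rw [← Real.exp_add]; simp
  have h3 := exp_neg_one_le
  norm_num at h1
  calc _ ≤ n * (Real.exp (-L) * Real.exp 1 * Real.exp (-1) ^ 3) := by gcongr
    _ = (n * Real.exp (-L)) * (Real.exp 1 * Real.exp (-1)) * Real.exp (-1) ^ 2 := by ring
    _ = β * Real.exp (-1) ^ 3 := by rw [h0, h2]; ring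
    _ ≤ β * (2 / 5) ^ 3 := by gcongr
    _ ≤ β / 5 := by linarith

theorem correlation_failure_le (hn : 1 ≤ n) (hp : p ≤ n) (hβ : 0 < β)
    (hL : L = 1 + Real.log (n / β)) (hL1 : 1 ≤ L) :
    p * (2 * Real.exp (1 / 2 - 4 * L)) ≤ β / 5 := by
  have h0 := exp_neg_mul_eq hn hβ hL
  have h1 := exp_sub_le_pow hL1 (r := 1 / 2) (by norm_num) 3
  have h2 : Real.exp 1 * Real.exp (-1) = 1 := by rw [← Real.exp_add]; simp
  have h3 := exp_neg_one_le
  norm_num at h1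
  calc _ ≤ n * (2 * (Real.exp (-L) * Real.exp 1 * Real.exp (-1) ^ 3)) := by
        norm_num
        gcongr
    _ = 2 * (n * Real.exp (-L)) * (Real.exp 1 * Real.exp (-1)) * Real.exp (-1) ^ 2 := by ring
    _ = 2 * β * Real.exp (-1) ^ 3 := by rw [h0, h2]; ring
    _ ≤ 2 * β * (2 / 5) ^ 3 := by gcongr
    _ ≤ β / 5 := by linarith

theorem noise_failure_le (hn : 1 ≤ n) (hp0 : 0 ≤ p) (hp : p ≤ n) (hβ : 0 < β)
    (hL : L = 1 + Real.log (n / β)) (hL1 : 1 ≤ L) (hT : T ≤ 1025 * L) :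
    T * p * Real.exp (7 / 20 - 12 * L) ≤ β / 5 := by
  have h0 := exp_neg_mul_eq hn hβ hL
  have h2 : Real.exp 1 * Real.exp (-1) = 1 := by rw [← Real.exp_add]; simp
  have h3 := exp_neg_one_le
  have h4 : L ≤ Real.exp (L - 1) := by linarith [Real.add_one_le_exp (L - 1)]
  have h5 : L * Real.exp (7 / 20 - 12 * L) ≤ Real.exp (-L) * Real.exp (-1) ^ 10 := by
    calc _ ≤ Real.exp (L - 1) * Real.exp (7 / 20 - 12 * L) := by gcongr
      _ ≤ _ := by
        rw [← Real.exp_add, ← Real.exp_nat_mul, ← Real.exp_add]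
        refine Real.exp_le_exp.2 ?_
        push_cast
        linarith
  calc _ ≤ (1025 * L) * n * Real.exp (7 / 20 - 12 * L) := by gcongr
    _ = 1025 * n * (L * Real.exp (7 / 20 - 12 * L)) := by ring
    _ ≤ 1025 * n * (Real.exp (-L) * Real.exp (-1) ^ 10) := by gcongr
    _ = 1025 * (n * Real.exp (-L)) * Real.exp (-1) ^ 10 := by ring
    _ = 1025 * β * Real.exp (-1) ^ 11 := by rw [h0]; ring
    _ ≤ 1025 * β * (2 / 5) ^ 11 := by gcongr
    _ ≤ β / 5 := by linarith

end Numeric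

theorem ofReal_one_sub_le_measure {Ω : Type*} [MeasurableSpace Ω] (P : Measure Ω)
    [IsProbabilityMeasure P] {A : Set Ω} {β : ℝ} (hβ : 0 ≤ β) (h : P Aᶜ ≤ ENNReal.ofReal β) :
    ENNReal.ofReal (1 - β) ≤ P A := by
  rw [ENNReal.ofReal_sub _ hβ, ENNReal.ofReal_one, tsub_le_iff_right]
  calc (1 : ℝ≥0∞) = P (A ∪ Aᶜ) := by rw [Set.union_compl_self, measure_univ]
    _ ≤ P A + P Aᶜ := measure_union_le _ _
    _ ≤ _ := by gcongr

/-- With probability at least `1 - β` the data are well conditioned and the noise is bounded. -/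
theorem prob_good_event_ge {n p T : ℕ} (hp : 1 ≤ p) (θ : Vec p) {σ β L lam : ℝ} (hσ : 0 < σ)
    (hβ : 0 < β) (hβ1 : β < 1) (hL : L = 1 + Real.log ((n : ℝ) / β)) (hL1 : 1 ≤ L) (hlam : 0 < lam)
    (hn : 20 * ((p : ℝ) + Real.log (1 / β)) ≤ n) (hpn : p ≤ n) (hT : (T : ℝ) ≤ 1025 * L) :
    ENNReal.ofReal (1 - β) ≤ ((dataLaw n p θ σ).prod (noiseLaw p T lam)) {ω |
      ((∀ u : Vec p, ∑ i, inner ℝ (ω.1 i).1 u ^ 2 ≤ 4 * n * ‖u‖ ^ 2) ∧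
        ∀ u : Vec p, n * ‖u‖ / 8 ≤ ∑ i, |inner ℝ (ω.1 i).1 u|) ∧
      (∀ i, ‖(ω.1 i).1‖ ≤ 4 * L * Real.sqrt p) ∧
      (∀ i, |(ω.1 i).2 - inner ℝ (ω.1 i).1 θ| ≤ 4 * L * σ) ∧
      (‖∑ i, ((ω.1 i).2 - inner ℝ (ω.1 i).1 θ) • (ω.1 i).1‖ ≤
        6 * L * σ * Real.sqrt n * Real.sqrt p) ∧
      ∀ t, ‖ω.2 t‖ ≤ 7 * L * lam * Real.sqrt p} := by
  have hn0 : 0 < n := by omega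
  have hn1 : (1 : ℝ) ≤ n := by exact_mod_cast hn0
  have hpn' : (p : ℝ) ≤ n := by exact_mod_cast hpn
  have b1 := (dataLaw_ill_conditioned_le (n := n) θ σ).trans
    (ENNReal.ofReal_le_ofReal (net_failure_le hp hβ hβ1 hn))
  have b2 := (dataLaw_norm_feature_gt_le (n := n) θ σ hL1).trans
    (ENNReal.ofReal_le_ofReal (feature_failure_le hn1 hpn' hβ hβ1 hL hL1))
  have b3 := (dataLaw_residual_gt_le (n := n) θ hσ hL1).trans
    (ENNReal.ofReal_le_ofReal (residual_failure_le hn1 hβ hL hL1))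
  have b4 := (dataLaw_noise_correlation_gt_le hn0 θ hσ hL1).trans
    (ENNReal.ofReal_le_ofReal (correlation_failure_le hn1 hpn' hβ hL hL1))
  have b5 := (noiseLaw_norm_gt_le (p := p) (T := T) hlam hL1).trans
    (ENNReal.ofReal_le_ofReal (noise_failure_le hn1 (by positivity) hpn' hβ hL hL1 hT))
  set P := (dataLaw n p θ σ).prod (noiseLaw p T lam)
  have hfst : ∀ {A : Set (Dataset n p)} {b : ℝ≥0∞}, dataLaw n p θ σ A ≤ b → P (A ×ˢ Set.univ) ≤ b :=
    fun h => by rwa [Measure.prod_prod, measure_univ, mul_one]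
  have hsnd : ∀ {A : Set (Fin T → Vec p)} {b : ℝ≥0∞}, noiseLaw p T lam A ≤ b →
      P (Set.univ ×ˢ A) ≤ b :=
    fun h => by rwa [Measure.prod_prod, measure_univ, one_mul]
  refine ofReal_one_sub_le_measure P hβ.le ?_
  have h5 : β = β / 5 + (β / 5 + (β / 5 + (β / 5 + β / 5))) := by ring
  have hβ5 : 0 ≤ β / 5 := by positivity
  rw [h5, ENNReal.ofReal_add hβ5 (by positivity), ENNReal.ofReal_add hβ5 (by positivity),
    ENNReal.ofReal_add hβ5 (by positivity), ENNReal.ofReal_add hβ5 (by positivity)]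
  refine le_trans (measure_mono fun ω hω => ?_) ((measure_union_le _ _).trans (add_le_add (hfst b1)
    ((measure_union_le _ _).trans (add_le_add (hfst b2) ((measure_union_le _ _).trans (add_le_add
      (hfst b3) ((measure_union_le _ _).trans (add_le_add (hfst b4) (hsnd b5)))))))))
  by_contra hcon
  refine hω ?_
  simp only [Set.mem_union, Set.mem_prod, Set.mem_univ, and_true, true_and, Set.mem_ofPred_eq,
    not_or, not_not] at hcon
  exact hcon

/-! ### Error rates and the choice of parameters -/

/-- The error bound of `norm_iterates_last_sub_le` in terms of the two statistical rates. -/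
theorem error_bound {n p T m : ℕ} (hn : 0 < n) (hp : 1 ≤ p)
    {σ₀ σ ρ L a γ lam : ℝ} (hσ₀ : 0 < σ₀) (hσ : 0 < σ) (hρ : 0 < ρ) (hL1 : 1 ≤ L) (ha : 0 < a)
    (hσL : σ₀ ≤ L ^ m * σ) (hnL : Real.exp (-L) ≤ 1 / n)
    (hγ : γ = a * L ^ (m + 2) * (σ * Real.sqrt p)) (hTL : 1024 * L ≤ T) (hT : (T : ℝ) ≤ 1025 * L)
    (hlam : lam = Real.sqrt (2 * (T : ℝ) * γ ^ 2 / (ρ * (n : ℝ) ^ 2))) :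
    (1 - 1 / 1024) ^ T + 2 * (T * (6 * L * σ * Real.sqrt p / Real.sqrt n +
      7 * L * lam * Real.sqrt p)) ≤ (1 / σ₀ + 12300 + 660100 * a) * L ^ (m + 5) *
        (Real.sqrt (σ ^ 2 * p / n) + σ * p / (Real.sqrt ρ * n)) := by
  have hn1 : (1 : ℝ) ≤ n := by exact_mod_cast hn
  have hp1 : (1 : ℝ) ≤ p := by exact_mod_cast hp
  have hL0 : 0 < L := by linarith
  have hT0 : (0 : ℝ) ≤ T := by positivity
  have hsn : 1 ≤ Real.sqrt n := Real.one_le_sqrt.2 hn1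
  have hsp : 1 ≤ Real.sqrt p := Real.one_le_sqrt.2 hp1
  have hsn2 : Real.sqrt n * Real.sqrt n = n := Real.mul_self_sqrt (by positivity)
  have hsp2 : Real.sqrt p * Real.sqrt p = p := Real.mul_self_sqrt (by positivity)
  have hsρ : 0 < Real.sqrt ρ := Real.sqrt_pos.2 hρ
  have e1 : Real.sqrt (σ ^ 2 * p / n) = σ * Real.sqrt p / Real.sqrt n := by
    rw [Real.sqrt_div (by positivity), Real.sqrt_mul (sq_nonneg σ), Real.sqrt_sq hσ.le]
  set t₁ := Real.sqrt (σ ^ 2 * p / n) with ht₁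
  set t₂ := σ * p / (Real.sqrt ρ * n) with ht₂
  have ht₁0 : 0 ≤ t₁ := Real.sqrt_nonneg _
  have ht₂0 : 0 ≤ t₂ := by positivity
  set A := L ^ (m + 5) with hA
  have hA0 : 0 < A := by positivity
  -- The optimization bias is at most `exp (-L) ≤ 1/n ≤ √p/√n`; `σ₀ ≤ L ^ m σ` supplies the missing
  -- factor `σ`.
  have c1 : (1 - 1 / 1024 : ℝ) ^ T ≤ 1 / σ₀ * A * t₁ := by
    have h1 : (1 - 1 / 1024 : ℝ) ^ T ≤ Real.exp (-L) := by
      calc (1 - 1 / 1024 : ℝ) ^ T ≤ Real.exp (-(1 / 1024)) ^ T := by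
            refine pow_le_pow_left₀ (by norm_num) ?_ T
            linarith [Real.add_one_le_exp (-(1 / 1024 : ℝ))]
        _ ≤ Real.exp (-L) := by
            rw [← Real.exp_nat_mul]
            exact Real.exp_le_exp.2 (by linarith)
    refine (h1.trans hnL).trans ?_
    rw [e1]
    calc (1 : ℝ) / n ≤ Real.sqrt p / Real.sqrt n := by
          rw [div_le_div_iff₀ (by positivity) (by positivity)]
          nlinarith
      _ = 1 / σ₀ * σ₀ * (Real.sqrt p / Real.sqrt n) := by field_simp
      _ ≤ 1 / σ₀ * (L ^ (m + 5) * σ) * (Real.sqrt p / Real.sqrt n) := by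
          have : L ^ m ≤ L ^ (m + 5) := pow_le_pow_right₀ hL1 (by omega)
          have : L ^ m * σ ≤ L ^ (m + 5) * σ := by gcongr
          have := hσL.trans this
          gcongr
      _ = _ := by ring
  have hL2 : L ^ 2 ≤ A := pow_le_pow_right₀ hL1 (by omega)
  have c2 : 2 * (T * (6 * L * σ * Real.sqrt p / Real.sqrt n)) ≤ 12300 * A * t₁ := by
    have e2 : 6 * L * σ * Real.sqrt p / Real.sqrt n = 6 * L * t₁ := by rw [e1]; ring
    rw [e2]
    calc _ ≤ 2 * (1025 * L * (6 * L * t₁)) := by gcongr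
      _ = 12300 * L ^ 2 * t₁ := by ring
      _ ≤ _ := by gcongr
  have c3 : 2 * (T * (7 * L * lam * Real.sqrt p)) ≤ 660100 * a * A * t₂ := by
    have hγ0 : 0 < γ := by rw [hγ]; positivity
    have hlam0 : 0 ≤ lam := by rw [hlam]; exact Real.sqrt_nonneg _
    -- `T ≤ 1025 L ≤ 1025 L²` and `2 * 1025 ≤ 46²`.
    have hlamle : lam ≤ 46 * L * γ / (Real.sqrt ρ * n) := by
      rw [hlam]
      refine Real.sqrt_le_iff.2 ⟨by positivity, ?_⟩
      rw [div_pow, mul_pow (Real.sqrt ρ), Real.sq_sqrt hρ.le]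
      gcongr
      have : L ≤ L ^ 2 := by nlinarith
      calc _ ≤ 2 * (1025 * L ^ 2) * γ ^ 2 := by gcongr; linarith
        _ ≤ _ := by nlinarith [mul_nonneg (sq_nonneg L) (sq_nonneg γ)]
    calc _ ≤ 2 * (1025 * L * (7 * L * (46 * L * γ / (Real.sqrt ρ * n)) * Real.sqrt p)) := by gcongr
      _ = 660100 * a * L ^ (m + 5) * (σ * (Real.sqrt p * Real.sqrt p) / (Real.sqrt ρ * n)) := by
          rw [hγ]; ring
      _ = _ := by rw [hsp2]
  have d1 : 0 ≤ 1 / σ₀ * A * t₂ := by positivity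
  have d2 : 0 ≤ a * A * t₁ := by positivity
  have d3 : 0 ≤ A * t₂ := by positivity
  linarith

end DPGD

theorem mainTheorem6 :
    ∃ (C₀ b : ℝ), 0 < C₀ ∧ 0 < b ∧
    ∀ (σ₀ : ℝ), 0 < σ₀ → ∀ (m : ℕ),
    ∃ (a C : ℝ) (k l : ℕ), 0 < a ∧ 0 < C ∧
    ∀ (n p : ℕ) (θstar : DPGD.Vec p) (σ ρ β L γ lam η : ℝ) (T : ℕ),
      1 ≤ p → ‖θstar‖ ≤ 1 → 0 < ρ → 0 < β → β < 1 →
      L = 1 + Real.log ((n : ℝ) / β) →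
      σ₀ / L ^ m ≤ σ →
      C₀ * ((p : ℝ) + Real.log (1 / β)) ≤ (n : ℝ) →
      γ = a * L ^ k * (σ * Real.sqrt p) →
      η = 1 / 4 →
      T = ⌈b * L⌉₊ →
      lam = Real.sqrt (2 * (T : ℝ) * γ ^ 2 / (ρ * (n : ℝ) ^ 2)) →
      DPGD.IsZCDP ρ
          (fun D : DPGD.Dataset n p => DPGD.mechanism γ lam η T 0 D) ∧
        ENNReal.ofReal (1 - β) ≤
          ((DPGD.dataLaw n p θstar σ).prod (DPGD.noiseLaw p T lam))
            {ω | ‖DPGD.iterates ω.1 γ η 0 ω.2 (Fin.last T) - θstar‖ ≤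
              C * L ^ l * (Real.sqrt (σ ^ 2 * p / n) +
                σ * p / (Real.sqrt ρ * n))} := by
  refine ⟨20, 1024, by norm_num, by norm_num, fun σ₀ hσ₀ m => ?_⟩
  -- With `B = 4 L √p`, `γ / (2B)` is `a L ^ (m + 1) σ / 8`. The part `32` makes it exceed the
  -- residual bound `4 L σ`; the part `2048 / σ₀` makes it exceed `256`.
  have ha : 0 < 32 + 2048 / σ₀ := by positivity
  refine ⟨32 + 2048 / σ₀, 1 / σ₀ + 12300 + 660100 * (32 + 2048 / σ₀), m + 2, m + 5, ha,
    by positivity, ?_⟩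
  intro n p θstar σ ρ β L γ lam η T hp hθ hρ hβ hβ1 hL hσL hn hγ hη hT hlam
  have hp1 : (1 : ℝ) ≤ p := by exact_mod_cast hp
  have hlogβ : 0 < Real.log (1 / β) := Real.log_pos (by rw [lt_div_iff₀ hβ]; linarith)
  have hpn' : (p : ℝ) ≤ n := by linarith
  have hpn : p ≤ n := by exact_mod_cast hpn'
  have hn0 : 0 < n := by omega
  have hn1 : (1 : ℝ) ≤ n := by exact_mod_cast hn0
  have hL1 : 1 ≤ L := by
    have : 0 ≤ Real.log (n / β) := Real.log_nonneg (by rw [le_div_iff₀ hβ]; linarith)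
    linarith
  have hL0 : 0 < L := by linarith
  have hσ : 0 < σ := lt_of_lt_of_le (by positivity) hσL
  have hσL' : σ₀ ≤ L ^ m * σ := by
    rw [div_le_iff₀ (by positivity)] at hσL
    linarith
  have hTL : 1024 * L ≤ T := by rw [hT]; exact Nat.le_ceil _
  have hTU : (T : ℝ) ≤ 1025 * L := by
    rw [hT]
    linarith [Nat.ceil_lt_add_one (by positivity : 0 ≤ 1024 * L)]
  have hT0 : 0 < T := by
    have : (0 : ℝ) < T := by linarith
    exact_mod_cast this
  have hsp : 0 < Real.sqrt p := Real.sqrt_pos.2 (by linarith)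
  have hγ0 : 0 < γ := by rw [hγ]; positivity
  have hlam0 : 0 < lam := by
    rw [hlam]
    have : (0 : ℝ) < T := by exact_mod_cast hT0
    positivity
  subst hη
  refine ⟨DPGD.isZCDP_mechanism hn0 hT0 hγ0 (by norm_num) hρ hlam 0, ?_⟩
  refine (DPGD.prob_good_event_ge hp θstar hσ hβ hβ1 hL hL1 hlam0 hn hpn hTU).trans
    (measure_mono ?_)
  rintro ⟨D, z⟩ ⟨⟨h1, h2⟩, h3, h4, h5, h6⟩
  have hU : γ / (2 * (4 * L * Real.sqrt p)) = (32 + 2048 / σ₀) * (L * (L ^ m * σ)) / 8 := by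
    rw [hγ]
    field_simp
    ring
  have hLσ : σ ≤ L ^ m * σ := le_mul_of_one_le_left hσ.le (one_le_pow₀ hL1)
  have hU1 : 4 * L * σ ≤ γ / (2 * (4 * L * Real.sqrt p)) := by
    rw [hU]
    have e1 : L * σ ≤ L * (L ^ m * σ) := by gcongr
    have e2 : 0 ≤ 2048 / σ₀ * (L * (L ^ m * σ)) := by positivity
    linarith
  have hU2 : 256 ≤ γ / (2 * (4 * L * Real.sqrt p)) := by
    rw [hU]
    have e1 : σ₀ ≤ L * (L ^ m * σ) := hσL'.trans (le_mul_of_one_le_left (by positivity) hL1)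
    have e2 : 2048 / σ₀ * σ₀ ≤ 2048 / σ₀ * (L * (L ^ m * σ)) := by gcongr
    rw [div_mul_cancel₀ _ hσ₀.ne'] at e2
    have e3 : 0 ≤ 32 * (L * (L ^ m * σ)) := by positivity
    linarith
  have hnL : Real.exp (-L) ≤ 1 / n := by
    rw [le_div_iff₀ (by positivity), mul_comm, DPGD.exp_neg_mul_eq hn1 hβ hL]
    nlinarith [DPGD.exp_neg_one_le, Real.exp_pos (-1)]
  refine (DPGD.norm_iterates_last_sub_le hn0 hT0 D hγ0 (by positivity)
    (g := 6 * L * σ * Real.sqrt p / Real.sqrt n) (N := 7 * L * lam * Real.sqrt p)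
    (by positivity) (by positivity) h3 h1 h2 hθ (fun i => (h4 i).trans hU1) hU2
    (h5.trans (le_of_eq ?_)) h6).trans
    (DPGD.error_bound hn0 hp hσ₀ hσ hρ hL1 ha hσL' hnL hγ hTL hTU hlam)
  have : Real.sqrt n * Real.sqrt n = n := Real.mul_self_sqrt (by positivity)
  have hsn : 0 < Real.sqrt n := Real.sqrt_pos.2 (by linarith)
  rw [mul_div_assoc', eq_div_iff hsn.ne', ← this]
  ring_nf
  simp
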